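/- Let $G=GL(n;\mathbb{C})$ and let $p\ge 1$. Let $NG(q)=G^q\ni(h_1,\dots,h_q)$ with the usual face operators $\varepsilon_i$ ($\varepsilon_0$ and $\varepsilon_q$ drop the first and the last factor, the others multiply $h_i$ and $h_{i+1}$), let $N\bar G(q)=G^{q+1}\ni(g_0,\dots,g_q)$, and let $\gamma:N\bar G(q)\to NG(q)$, $\gamma(g_0,\dots,g_q)=(g_0g_1^{-1},\dots,g_{q-1}g_q^{-1})$. On $\Delta^q\times N\bar G(q)$ let $\theta=t_0\theta_0+\cdots+t_q\theta_q$, where $t_0,\dots,t_q$ are the barycentric coordinates of the simplex $\Delta^q$ and $\theta_i=g_i^{-1}dg_i$ is the pullback of the Maurer–Cartan form of $G$ under the projection to the $i$-th factor, and let $\Omega=d\theta+\frac12[\theta,\theta]$ be its curvature. A simplicial $m$-form on $NG$ is a sequence of smooth complex-valued $m$-forms $\Phi^{(q)}$ on $\Delta^q\times NG(q)$ with $(\varepsilon^i\times\mathrm{id})^*\Phi^{(q)}=(\mathrm{id}\times\varepsilon_i)^*\Phi^{(q-1)}$ for $0\le i\le q$, where $\varepsilon^i:\Delta^{q-1}\to\Delta^q$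 is the $i$-th face map. There is a simplicial $2p$-form $\Phi$ on $NG$ that represents the $p$-th Chern character in the sense of Chern–Weil theory, i.e. such that for all $q$ $$(\mathrm{id}\times\gamma)^*\Phi^{(q)}=\frac1{p!}\,\mathrm{tr}\left(\left(\frac{-\Omega}{2\pi i}\right)^p\right)\quad\text{on }\Delta^q\times N\bar G(q).$$ For every such $\Phi$, the component $$\omega_p=\int_{\Delta^p}\Phi^{(p)}\in\Omega^p(NG(p))$$ of the associated cochain $I_\Delta(\Phi)=\big(\int_{\Delta^q}\Phi^{(q)}\big)_q$ in the simplicial de Rham complex $\Omega^{2p}(NG)=\bigoplus_{q+k=2p}\Omega^{k}(NG(q))$ is $$\omega_p=(-1)^{p(p-1)/2}\,\frac{1}{p!\,(p-1)!}\left(\frac1{2\pi i}\right)^p\mathrm{tr}\left(\varphi_1\wedge\sum_{\sigma\in\mathfrak S_{p-1}}\mathrm{sgn}(\sigma)\,\varphi_{\sigma(1)+1}\wedge\cdots\wedge\varphi_{\sigma(p-1)+1}\right),$$ where $\varphi_s=h_1\cdots h_{s-1}\,dh_s\,h_s^{-1}\cdots h_1^{-1}$, and for $p=1$ the sum is the constant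 identity matrix. Here integration along the fibre $\Delta^q$ is normalized by $\int_{\Delta^q}a\,dt_1\wedge\cdots\wedge dt_q\wedge\eta=\big(\int_{\Delta^q}a\,dt_1\cdots dt_q\big)\eta$ for forms $\eta$ in the directions of $NG(q)$. -/

import Mathlib

open scoped ContDiff

noncomputable section

namespace SimplicialDeRham

/-! ### Differential forms on (subsets of) normed spaces

A real differential `k`-form on a subset of `E` with values in `F` is, as for `extDeriv`,
a function `E → E [⋀^Fin k]→L[ℝ] F`, whose values outside the subset are irrelevant. -/

section Forms

variable {E E' F F' F'' : Type*}
  [NormedAddCommGroup E] [NormedSpace ℝ E] [NormedAddCommGroup E'] [NormedSpace ℝ E']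
  [NormedAddCommGroup F] [NormedSpace ℝ F] [NormedAddCommGroup F'] [NormedSpace ℝ F']
  [NormedAddCommGroup F''] [NormedSpace ℝ F'']

/-- The `1`-form given by a field of linear maps. -/
def oneForm (a : E → E →L[ℝ] F) : E → E [⋀^Fin 1]→L[ℝ] F :=
  fun x => ContinuousAlternatingMap.ofSubsingleton ℝ E F (0 : Fin 1) (a x)

/-- The pullback `f^* α` of a differential form. -/
def pullback {k : ℕ} (f : E → E') (α : E' → E' [⋀^Fin k]→L[ℝ] F) : E → E [⋀^Fin k]→L[ℝ] F :=
  fun x => (α (f x)).compContinuousLinearMap (fderiv ℝ f x)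

/-- Renaming of the degree along an equality `k = l`. -/
def castDegree {k l : ℕ} (h : k = l) (α : E → E [⋀^Fin k]→L[ℝ] F) : E → E [⋀^Fin l]→L[ℝ] F :=
  h ▸ α

/-- The multilinear map `(v₁, …, v_{k+l}) ↦ B (α (v₁, …, v_k)) (β (v_{k+1}, …, v_{k+l}))`. -/
def mulForms {k l : ℕ} (B : F →L[ℝ] F' →L[ℝ] F'')
    (α : E [⋀^Fin k]→L[ℝ] F) (β : E [⋀^Fin l]→L[ℝ] F') :
    ContinuousMultilinearMap ℝ (fun _ : Fin (k + l) => E) F'' where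
  toFun v := B (α fun i => v (Fin.castAdd l i)) (β fun j => v (Fin.natAdd k j))
  map_update_add' := by
    intro inst v i x y
    obtain rfl : inst = instDecidableEqFin (k + l) := Subsingleton.elim _ _
    have hL : ∀ (a : Fin k) (z : E), (fun i => Function.update v (Fin.castAdd l a) z (Fin.castAdd l i))
        = Function.update (fun i => v (Fin.castAdd l i)) a z := by
      intro a z; funext b; simp [Function.update_apply]
    have hL' : ∀ (a : Fin k) (z : E), (fun j => Function.update v (Fin.castAdd l a) z (Fin.natAdd k j))
        = (fun j => v (Fin.natAdd k j)) := by
      intro a z; funext b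
      rw [Function.update_of_ne]
      intro h; have := congrArg Fin.val h; simp at this; omega
    have hR : ∀ (a : Fin l) (z : E), (fun j => Function.update v (Fin.natAdd k a) z (Fin.natAdd k j))
        = Function.update (fun j => v (Fin.natAdd k j)) a z := by
      intro a z; funext b; simp [Function.update_apply]
    have hR' : ∀ (a : Fin l) (z : E), (fun i => Function.update v (Fin.natAdd k a) z (Fin.castAdd l i))
        = (fun i => v (Fin.castAdd l i)) := by
      intro a z; funext b
      rw [Function.update_of_ne]
      intro h; have := congrArg Fin.val h; simp at this; omega
    refine Fin.addCases (fun a => ?_) (fun a => ?_) i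
    · simp only [hL, hL', ContinuousAlternatingMap.map_update_add, map_add,
        add_apply]
    · simp only [hR, hR', ContinuousAlternatingMap.map_update_add, map_add]
  map_update_smul' := by
    intro inst v i c x
    obtain rfl : inst = instDecidableEqFin (k + l) := Subsingleton.elim _ _
    have hL : ∀ (a : Fin k) (z : E), (fun i => Function.update v (Fin.castAdd l a) z (Fin.castAdd l i))
        = Function.update (fun i => v (Fin.castAdd l i)) a z := by
      intro a z; funext b; simp [Function.update_apply]
    have hL' : ∀ (a : Fin k) (z : E), (fun j => Function.update v (Fin.castAdd l a) z (Fin.natAdd k j))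
        = (fun j => v (Fin.natAdd k j)) := by
      intro a z; funext b
      rw [Function.update_of_ne]
      intro h; have := congrArg Fin.val h; simp at this; omega
    have hR : ∀ (a : Fin l) (z : E), (fun j => Function.update v (Fin.natAdd k a) z (Fin.natAdd k j))
        = Function.update (fun j => v (Fin.natAdd k j)) a z := by
      intro a z; funext b; simp [Function.update_apply]
    have hR' : ∀ (a : Fin l) (z : E), (fun i => Function.update v (Fin.natAdd k a) z (Fin.castAdd l i))
        = (fun i => v (Fin.castAdd l i)) := by
      intro a z; funext b
      rw [Function.update_of_ne]
      intro h; have := congrArg Fin.val h; simp at this; omega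
    refine Fin.addCases (fun a => ?_) (fun a => ?_) i
    · simp only [hL, hL', ContinuousAlternatingMap.map_update_smul, map_smul,
        smul_apply]
    · simp only [hR, hR', ContinuousAlternatingMap.map_update_smul, map_smul]
  cont := by
    have h1 : Continuous fun v : Fin (k + l) → E => α fun i => v (Fin.castAdd l i) :=
      α.coe_continuous.comp (continuous_pi fun i => continuous_apply _)
    have h2 : Continuous fun v : Fin (k + l) → E => β fun j => v (Fin.natAdd k j) :=
      β.coe_continuous.comp (continuous_pi fun i => continuous_apply _)
    exact (B.continuous.comp h1).clm_apply h2

/-- The wedge product of vector-valued forms with respect to a bilinear map `B`, with the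
normalization `(α ∧ β)(v) = 1/(k! l!) ∑_σ sgn σ · B (α (v_{σ 1}, …)) (β (v_{σ (k+1)}, …))`,
so that `(α ∧ β)(v, w) = B (α v) (β w) - B (α w) (β v)` for `1`-forms. -/
def wedge {k l : ℕ} (B : F →L[ℝ] F' →L[ℝ] F'')
    (α : E → E [⋀^Fin k]→L[ℝ] F) (β : E → E [⋀^Fin l]→L[ℝ] F') :
    E → E [⋀^Fin (k + l)]→L[ℝ] F'' :=
  fun x => ((k.factorial * l.factorial : ℝ)⁻¹) •
    ContinuousMultilinearMap.alternatization (mulForms B (α x) (β x))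

theorem append_update {X : Type*} {q k : ℕ} (u : Fin q → X) (v : Fin k → X) (a : Fin k) (z : X) :
    Fin.append u (Function.update v a z) = Function.update (Fin.append u v) (Fin.natAdd q a) z := by
  funext b
  refine Fin.addCases (fun c => ?_) (fun c => ?_) b
  · rw [Function.update_of_ne, Fin.append_left, Fin.append_left]
    intro h; have := congrArg Fin.val h; simp at this; omega
  · simp [Function.update_apply]

/-- The form `f(u₁, …, u_q, -)` of degree `k`, for `f` of degree `q + k`. -/
def contract {q k : ℕ} (f : E [⋀^Fin (q + k)]→L[ℝ] F) (u : Fin q → E) : E [⋀^Fin k]→L[ℝ] F where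
  toFun v := f (Fin.append u v)
  map_update_add' := by
    intro inst v i x y
    obtain rfl : inst = instDecidableEqFin k := Subsingleton.elim _ _
    simp only [append_update, ContinuousAlternatingMap.map_update_add]
  map_update_smul' := by
    intro inst v i c x
    obtain rfl : inst = instDecidableEqFin k := Subsingleton.elim _ _
    simp only [append_update, ContinuousAlternatingMap.map_update_smul]
  cont := by
    refine f.coe_continuous.comp (continuous_pi fun i => ?_)
    refine Fin.addCases (fun a => ?_) (fun a => ?_) i
    · simp only [Fin.append_left]; exact continuous_const
    · simp only [Fin.append_right]; exact continuous_apply a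
  map_eq_zero_of_eq' := by
    intro v i j hv hij
    refine f.map_eq_zero_of_eq _ (i := Fin.natAdd q i) (j := Fin.natAdd q j) (by simpa using hv) ?_
    intro h; exact hij (by simpa using h)

end Forms

/-! ### Matrix-valued forms -/

/-- The `n × n` complex matrices: the Lie algebra of `GL(n, ℂ)`, which contains `GL(n, ℂ)` as the
open subset of invertible matrices. (A type of its own, so that the operator norm, which only
serves to fix the usual topology, is its only normed structure.) -/
def Mat (n : ℕ) : Type := Matrix (Fin n) (Fin n) ℂ

open scoped Matrix.Norms.Operator in
instance (n : ℕ) : NormedRing (Mat n) :=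
  inferInstanceAs (NormedRing (Matrix (Fin n) (Fin n) ℂ))

open scoped Matrix.Norms.Operator in
instance (n : ℕ) : NormedAlgebra ℂ (Mat n) :=
  inferInstanceAs (NormedAlgebra ℂ (Matrix (Fin n) (Fin n) ℂ))

instance (n : ℕ) : FiniteDimensional ℂ (Mat n) :=
  inferInstanceAs (FiniteDimensional ℂ (Matrix (Fin n) (Fin n) ℂ))

/-- The trace of a matrix, as an `ℝ`-linear map. -/
def trace (n : ℕ) : Mat n →L[ℝ] ℂ :=
  LinearMap.toContinuousLinearMap
    ((Matrix.traceLinearMap (Fin n) ℂ ℂ : Mat n →ₗ[ℂ] ℂ).restrictScalars ℝ)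

section MatrixForms

variable {E : Type*} [NormedAddCommGroup E] [NormedSpace ℝ E] {n : ℕ}

/-- Wedge product of matrix-valued forms, through the matrix product. -/
def wedgeMul {k l : ℕ} (α : E → E [⋀^Fin k]→L[ℝ] Mat n) (β : E → E [⋀^Fin l]→L[ℝ] Mat n) :
    E → E [⋀^Fin (k + l)]→L[ℝ] Mat n :=
  wedge (ContinuousLinearMap.mul ℝ (Mat n)) α β

/-- The product `[α, β]` of matrix-valued forms, through the commutator bracket. -/
def wedgeLie {k l : ℕ} (α : E → E [⋀^Fin k]→L[ℝ] Mat n) (β : E → E [⋀^Fin l]→L[ℝ] Mat n) :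
    E → E [⋀^Fin (k + l)]→L[ℝ] Mat n :=
  wedge (ContinuousLinearMap.mul ℝ (Mat n) - (ContinuousLinearMap.mul ℝ (Mat n)).flip) α β

/-- The constant `0`-form with value the identity matrix. -/
def oneZeroForm : E → E [⋀^Fin 0]→L[ℝ] Mat n :=
  fun _ => ContinuousAlternatingMap.constOfIsEmpty ℝ E (Fin 0) 1

/-- The `p`-th wedge power of a matrix-valued `2`-form. -/
def wedgePow (Ω : E → E [⋀^Fin 2]→L[ℝ] Mat n) : (p : ℕ) → E → E [⋀^Fin (2 * p)]→L[ℝ] Mat n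
  | 0 => oneZeroForm
  | p + 1 => wedgeMul (wedgePow Ω p) Ω

/-- The ordered product `α₁ ∧ ⋯ ∧ α_k` of matrix-valued `1`-forms. -/
def wedgeProd : {k : ℕ} → (Fin k → E → E [⋀^Fin 1]→L[ℝ] Mat n) → E → E [⋀^Fin k]→L[ℝ] Mat n
  | 0, _ => oneZeroForm
  | k + 1, α => wedgeMul (wedgeProd fun i : Fin k => α i.castSucc) (α (Fin.last k))

/-- The trace of a matrix-valued form. -/
def traceForm {k : ℕ} (α : E → E [⋀^Fin k]→L[ℝ] Mat n) : E → E [⋀^Fin k]→L[ℝ] ℂ :=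
  fun x => (trace n).compContinuousAlternatingMap (α x)

end MatrixForms

/-! ### The standard simplex

The affine coordinates `(t₁, …, t_q)` identify `Δ^q` with a subset of `ℝ^q`, with
`t₀ = 1 - t₁ - ⋯ - t_q`, and orient it by `dt₁ ∧ ⋯ ∧ dt_q`. -/

/-- The barycentric coordinates `(t₀, t₁, …, t_q)`. -/
def bary {q : ℕ} (t : Fin q → ℝ) : Fin (q + 1) → ℝ :=
  Fin.cons (1 - ∑ i, t i) t

/-- The simplex `Δ^q`. -/
def simplex (q : ℕ) : Set (Fin q → ℝ) :=
  {t | bary t ∈ stdSimplex ℝ (Fin (q + 1))}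

/-- The `i`-th face map `ε^i : Δ^q → Δ^{q+1}`, which inserts `0` as the `i`-th barycentric
coordinate. -/
def simplexFace {q : ℕ} (i : Fin (q + 2)) (t : Fin q → ℝ) : Fin (q + 1) → ℝ :=
  Fin.tail (Fin.insertNth (α := fun _ => ℝ) i 0 (bary t))

/-! ### The simplicial manifolds `NG` and `N\bar G` for `G = GL(n, ℂ)` -/

/-- `NG(q) = G^q`, an open subset of the space of `q`-tuples of matrices. -/
def NG (n q : ℕ) : Set (Fin q → Mat n) :=
  {h | ∀ j, IsUnit (h j)}

/-- `N\bar G(q) = G^{q+1}`. -/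
def NGbar (n q : ℕ) : Set (Fin (q + 1) → Mat n) :=
  {g | ∀ j, IsUnit (g j)}

/-- The face operator `ε_i : NG(q+1) → NG(q)`: `ε_0` and `ε_{q+1}` drop the first and the last
factor, the others multiply the `i`-th and the `(i+1)`-st factor. -/
def face {n q : ℕ} (i : Fin (q + 2)) (h : Fin (q + 1) → Mat n) : Fin q → Mat n :=
  fun j =>
    if (j : ℕ) + 1 < i then h j.castSucc
    else if (j : ℕ) + 1 = i then h j.castSucc * h j.succ
    else h j.succ

/-- The projection `γ(g_0, …, g_q) = (g_0 g_1⁻¹, …, g_{q-1} g_q⁻¹)` of the universal bundle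
(`Ring.inverse g` is `g⁻¹` for invertible `g`). -/
def gamma {n q : ℕ} (g : Fin (q + 1) → Mat n) : Fin q → Mat n :=
  fun j => g j.castSucc * Ring.inverse (g j.succ)

/-! ### The canonical connection and its curvature -/

/-- The Maurer-Cartan form `g⁻¹ dg` of `G`. -/
def maurerCartan (n : ℕ) : Mat n → Mat n [⋀^Fin 1]→L[ℝ] Mat n :=
  oneForm fun g => ContinuousLinearMap.mul ℝ (Mat n) (Ring.inverse g)

/-- The connection `θ = t₀ θ₀ + ⋯ + t_q θ_q` on `Δ^q × N\bar G(q)`, where `θ_i` is the pullback of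
the Maurer-Cartan form along the projection to the `i`-th factor of `N\bar G(q)`. -/
def connection (n q : ℕ) : (Fin q → ℝ) × (Fin (q + 1) → Mat n) →
    ((Fin q → ℝ) × (Fin (q + 1) → Mat n)) [⋀^Fin 1]→L[ℝ] Mat n :=
  fun x => ∑ i : Fin (q + 1), bary x.1 i •
    pullback (fun y : (Fin q → ℝ) × (Fin (q + 1) → Mat n) => y.2 i) (maurerCartan n) x

/-- The curvature `Ω = dθ + ½ [θ, θ]`. -/
def curvature (n q : ℕ) : (Fin q → ℝ) × (Fin (q + 1) → Mat n) →
    ((Fin q → ℝ) × (Fin (q + 1) → Mat n)) [⋀^Fin 2]→L[ℝ] Mat n :=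
  fun x => extDeriv (connection n q) x +
    (1 / 2 : ℝ) • wedgeLie (connection n q) (connection n q) x

/-- The form `ch_p(Ω) = (1/p!) tr ((-Ω / 2πi)^p)` on `Δ^q × N\bar G(q)`. -/
def chernCharacterForm (n p q : ℕ) : (Fin q → ℝ) × (Fin (q + 1) → Mat n) →
    ((Fin q → ℝ) × (Fin (q + 1) → Mat n)) [⋀^Fin (2 * p)]→L[ℝ] ℂ :=
  fun x => (1 / (p.factorial : ℂ)) •
    traceForm (wedgePow (fun y => (-(1 / (2 * Real.pi * Complex.I)) : ℂ) • curvature n q y) p) x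

/-! ### Simplicial forms on `NG` -/

/-- A (smooth, complex-valued) simplicial `m`-form on `NG`. -/
structure SimplicialForm (n m : ℕ) where
  form : ∀ q : ℕ, (Fin q → ℝ) × (Fin q → Mat n) →
    ((Fin q → ℝ) × (Fin q → Mat n)) [⋀^Fin m]→L[ℝ] ℂ
  smooth : ∀ q, ContDiffOn ℝ ∞ (form q) (simplex q ×ˢ NG n q)
  compatible : ∀ (q : ℕ) (i : Fin (q + 2)),
    Set.EqOn
      (pullback (fun y : (Fin q → ℝ) × (Fin (q + 1) → Mat n) => (simplexFace i y.1, y.2))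
        (form (q + 1)))
      (pullback (fun y : (Fin q → ℝ) × (Fin (q + 1) → Mat n) => (y.1, face i y.2)) (form q))
      (simplex q ×ˢ NG n (q + 1))

/-- `Φ` is the simplicial form `ch_p(Ω)` on `NG` given by Chern-Weil theory: on each
`Δ^q × NG(q)` it is the form whose pullback along `id × γ` is `ch_p(Ω)`. -/
def IsChernWeilForm {n : ℕ} (p : ℕ) (Φ : SimplicialForm n (2 * p)) : Prop :=
  ∀ q : ℕ, Set.EqOn
    (pullback (fun y : (Fin q → ℝ) × (Fin (q + 1) → Mat n) => (y.1, gamma y.2)) (Φ.form q))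
    (chernCharacterForm n p q)
    (simplex q ×ˢ NGbar n q)

/-- The component in `Ω^k(NG(q))`, where `q + k = m`, of the cochain `I_Δ(Φ)` in the total complex
`Ω^m(NG)`: the integral of `Φ` along the fibre `Δ^q`, where
`∫_{Δ^q} a dt₁ ∧ ⋯ ∧ dt_q ∧ η = (∫_{Δ^q} a dt₁ ⋯ dt_q) η` for forms `η` from `NG(q)`. -/
def integrateSimplex {n m : ℕ} (Φ : SimplicialForm n m) (q k : ℕ) (hm : m = q + k) :
    (Fin q → Mat n) → (Fin q → Mat n) [⋀^Fin k]→L[ℝ] ℂ :=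
  fun h => ∫ t in simplex q,
    (contract (castDegree hm (Φ.form q) (t, h)) fun i => (Pi.single i 1, 0)).compContinuousLinearMap
      (ContinuousLinearMap.inr ℝ (Fin q → ℝ) (Fin q → Mat n))

/-! ### The explicit cochain -/

/-- The matrix-valued `1`-form `φ_s = h_1 ⋯ h_{s-1} dh_s h_s⁻¹ ⋯ h_1⁻¹` on `NG(q)`; the factors are
numbered from `0` here, so that `phi s` is `φ_{s+1}`. -/
def phi {n q : ℕ} (s : Fin q) : (Fin q → Mat n) → (Fin q → Mat n) [⋀^Fin 1]→L[ℝ] Mat n :=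
  oneForm fun h =>
    (ContinuousLinearMap.mulLeftRight ℝ (Mat n) ((List.ofFn h).take s).prod
      (Ring.inverse ((List.ofFn h).take (s + 1)).prod)).comp
      (ContinuousLinearMap.proj (R := ℝ) (φ := fun _ : Fin q => Mat n) s)

/-- The form `∑_{σ ∈ 𝔖_{p-1}} sgn(σ) φ_{σ(1)+1} ⋯ φ_{σ(p-1)+1}` on `NG(p)`. -/
def alternatingSum (n p : ℕ) :
    (Fin p → Mat n) → (Fin p → Mat n) [⋀^Fin (p - 1)]→L[ℝ] Mat n :=
  fun h => ∑ σ : Equiv.Perm (Fin (p - 1)), ((Equiv.Perm.sign σ : ℤ) : ℝ) •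
    wedgeProd (fun j : Fin (p - 1) => phi (⟨(σ j : ℕ) + 1, by have := (σ j).2; omega⟩ : Fin p)) h

end SimplicialDeRham

end

/-! Existence. By the Maurer–Cartan equation dθ_i = -θ_i ∧ θ_i, the curvature is Σ dt_i ∧ θ_i - Σ
t_i θ_i ∧ θ_i + θ ∧ θ, the antisymmetrization of the bilinear expression `curvCoeff`
(`curvature_apply`). Since Σ dt_i = 0 and Σ t_i = 1, replacing every θ_i by c (θ_i - z) c⁻¹ merely
conjugates this expression (`curvCoeff_conj_shift`). For z = θ_0 and c = g_0 the new forms are the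
pullbacks along γ of -(φ_1 + ⋯ + φ_i) (`partialSum_gamma`), so the Chern character form is the
pullback of an explicit smooth form `trivChernForm` on Δ^q × NG(q). As γ is a surjective submersion,
face compatibility can be checked on N\bar G, where ε_i just forgets g_i; for the same reason every
Chern–Weil form agrees with `trivChernForm` over Δ^q × NG(q) (`IsChernWeilForm.form_eq`).

The component. Insert the p coordinate vectors of Δ^p and p vectors v_j tangent to NG(p).
`curvCoeff` vanishes when a simplex vector stands in its second slot, so in a product of p factors
the second slots hold exactly the v_j and the first slots the simplex vectors; unshuffling costs
(-1)^(p(p-1)/2) (`sum_sign_smul_pairs`). The factor for the i-th simplex vector and v is -(φ_1 + ⋯ +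
φ_i)(v), a triangular linear combination of the φ_s, so antisymmetrizing replaces these sums by the
φ_s themselves at the cost of the determinant (-1)^p (`sum_sign_smul_linearCombination`). That sign
cancels the one in (-Ω)^p. The cyclicity of the trace lets φ_1 be moved to the front, with a factor
p (`sum_sign_trace_eq`). The result does not depend on t, so integration multiplies by the volume
1/p!, and p/(p! p!) = 1/(p! (p-1)!). -/

noncomputable section

namespace SimplicialDeRham

/-! ### Antisymmetrized products -/

section Antisymmetrization

variable {E A : Type*} [Ring A]

/-- The block permutation of `Fin (k + l)` given by permutations of the two blocks. -/
def blockPerm {k l : ℕ} (ρ : Equiv.Perm (Fin k)) (π : Equiv.Perm (Fin l)) :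
    Equiv.Perm (Fin (k + l)) :=
  finSumFinEquiv.permCongr (Equiv.Perm.sumCongr ρ π)

@[simp]
theorem blockPerm_castAdd {k l : ℕ} (ρ : Equiv.Perm (Fin k)) (π : Equiv.Perm (Fin l)) (i : Fin k) :
    blockPerm ρ π (Fin.castAdd l i) = Fin.castAdd l (ρ i) := by
  simp [blockPerm, Equiv.permCongr_apply]

@[simp]
theorem blockPerm_natAdd {k l : ℕ} (ρ : Equiv.Perm (Fin k)) (π : Equiv.Perm (Fin l)) (j : Fin l) :
    blockPerm ρ π (Fin.natAdd k j) = Fin.natAdd k (π j) := by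
  simp [blockPerm, Equiv.permCongr_apply]

@[simp]
theorem sign_blockPerm {k l : ℕ} (ρ : Equiv.Perm (Fin k)) (π : Equiv.Perm (Fin l)) :
    Equiv.Perm.sign (blockPerm ρ π) = Equiv.Perm.sign ρ * Equiv.Perm.sign π := by
  simp [blockPerm]

/-- Right translation by a block permutation permutes the sum, and the sign it introduces is the
product of the two block signs, which squares to one. -/
theorem sum_sign_smul_comp_blockPerm {k l : ℕ} (H : Equiv.Perm (Fin (k + l)) → A)
    (ρ : Equiv.Perm (Fin k)) (π : Equiv.Perm (Fin l)) :
    ∑ σ : Equiv.Perm (Fin (k + l)), Equiv.Perm.sign σ •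
        (Equiv.Perm.sign ρ * Equiv.Perm.sign π) • H (σ * blockPerm ρ π) =
      ∑ σ : Equiv.Perm (Fin (k + l)), Equiv.Perm.sign σ • H σ := by
  refine Fintype.sum_equiv (Equiv.mulRight (blockPerm ρ π)) _ _ fun σ => ?_
  simp [smul_smul]

/-- The antisymmetrization of a product of two antisymmetrizations is a multiple of the
antisymmetrization of the product. -/
theorem sum_sign_smul_mul_sum_sign_smul {k l : ℕ} (F : (Fin k → E) → A) (G : (Fin l → E) → A)
    (v : Fin (k + l) → E) :
    ∑ σ : Equiv.Perm (Fin (k + l)), Equiv.Perm.sign σ •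
        ((∑ ρ : Equiv.Perm (Fin k), Equiv.Perm.sign ρ • F fun i => v (σ (Fin.castAdd l (ρ i)))) *
          ∑ π : Equiv.Perm (Fin l), Equiv.Perm.sign π • G fun j => v (σ (Fin.natAdd k (π j)))) =
      (k.factorial * l.factorial) • ∑ σ : Equiv.Perm (Fin (k + l)), Equiv.Perm.sign σ •
        ((F fun i => v (σ (Fin.castAdd l i))) * G fun j => v (σ (Fin.natAdd k j))) := by
  simp_rw [Finset.sum_mul_sum, Finset.smul_sum]
  rw [Finset.sum_comm]
  -- Each pair (ρ, π) contributes the same sum over σ, because ρ and π can be absorbed into σ;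
  -- counting the pairs gives k! l!, the normalization of `wedge`.
  have key : ∀ ρ : Equiv.Perm (Fin k), (∑ σ : Equiv.Perm (Fin (k + l)),
      ∑ π : Equiv.Perm (Fin l), Equiv.Perm.sign σ •
        ((Equiv.Perm.sign ρ • F fun i => v (σ (Fin.castAdd l (ρ i)))) *
          Equiv.Perm.sign π • G fun j => v (σ (Fin.natAdd k (π j))))) =
      l.factorial • ∑ σ : Equiv.Perm (Fin (k + l)), Equiv.Perm.sign σ •
        ((F fun i => v (σ (Fin.castAdd l i))) * G fun j => v (σ (Fin.natAdd k j))) := by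
    intro ρ
    rw [Finset.sum_comm]
    rw [Finset.sum_congr rfl fun π _ => ?_, Finset.sum_const, Finset.card_univ,
      Fintype.card_perm, Fintype.card_fin]
    rw [← sum_sign_smul_comp_blockPerm (fun σ => (F fun i => v (σ (Fin.castAdd l i))) *
      G fun j => v (σ (Fin.natAdd k j))) ρ π]
    refine Finset.sum_congr rfl fun σ _ => ?_
    simp [smul_mul_smul_comm]
  rw [Finset.sum_congr rfl fun ρ _ => key ρ, Finset.sum_const, Finset.card_univ,
      Fintype.card_perm, Fintype.card_fin, smul_smul, Finset.smul_sum]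

end Antisymmetrization

/-! ### Values of products of matrix-valued forms -/

section Values

variable {E : Type*} [NormedAddCommGroup E] [NormedSpace ℝ E] {n : ℕ}

theorem wedge_apply {F F' F'' : Type*} [NormedAddCommGroup F] [NormedSpace ℝ F]
    [NormedAddCommGroup F'] [NormedSpace ℝ F'] [NormedAddCommGroup F''] [NormedSpace ℝ F'']
    {k l : ℕ} (B : F →L[ℝ] F' →L[ℝ] F'')
    (α : E → E [⋀^Fin k]→L[ℝ] F) (β : E → E [⋀^Fin l]→L[ℝ] F') (x : E) (v : Fin (k + l) → E) :
    wedge B α β x v = ((k.factorial * l.factorial : ℝ)⁻¹) •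
      ∑ σ : Equiv.Perm (Fin (k + l)), Equiv.Perm.sign σ •
        B (α x fun i => v (σ (Fin.castAdd l i))) (β x fun j => v (σ (Fin.natAdd k j))) := by
  simp only [wedge, ContinuousAlternatingMap.smul_apply,
    ContinuousMultilinearMap.alternatization_apply_apply]
  rfl

theorem wedge_one_one_apply {F F' F'' : Type*} [NormedAddCommGroup F] [NormedSpace ℝ F]
    [NormedAddCommGroup F'] [NormedSpace ℝ F'] [NormedAddCommGroup F''] [NormedSpace ℝ F'']
    (B : F →L[ℝ] F' →L[ℝ] F'')
    (α : E → E [⋀^Fin 1]→L[ℝ] F) (β : E → E [⋀^Fin 1]→L[ℝ] F') (x : E) (v : Fin 2 → E) :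
    wedge B α β x v = B (α x fun _ => v 0) (β x fun _ => v 1) -
      B (α x fun _ => v 1) (β x fun _ => v 0) := by
  rw [wedge_apply]
  have h : ∀ f : Equiv.Perm (Fin 2) → F'', ∑ σ, f σ = f 1 + f (Equiv.swap 0 1) := by
    intro f
    rw [show (Finset.univ : Finset (Equiv.Perm (Fin 2))) = {1, Equiv.swap 0 1} by decide,
      Finset.sum_pair (by decide)]
  rw [h]
  have e0 : ∀ i : Fin 1, Fin.castAdd 1 i = (0 : Fin 2) := by decide
  have e1 : ∀ i : Fin 1, i.succ = (1 : Fin 2) := by decide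
  simp [e0, e1, sub_eq_add_neg]

/-- If two forms are the antisymmetrizations of `F` and `G`, their product is the
antisymmetrization of the product of `F` and `G`. -/
theorem wedgeMul_apply_of_antisymm {k l : ℕ} {α : E → E [⋀^Fin k]→L[ℝ] Mat n}
    {β : E → E [⋀^Fin l]→L[ℝ] Mat n} {x : E} {F : (Fin k → E) → Mat n} {G : (Fin l → E) → Mat n}
    (hα : ∀ v, α x v = ∑ ρ : Equiv.Perm (Fin k), Equiv.Perm.sign ρ • F fun i => v (ρ i))
    (hβ : ∀ v, β x v = ∑ π : Equiv.Perm (Fin l), Equiv.Perm.sign π • G fun i => v (π i))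
    (v : Fin (k + l) → E) :
    wedgeMul α β x v = ∑ σ : Equiv.Perm (Fin (k + l)), Equiv.Perm.sign σ •
      ((F fun i => v (σ (Fin.castAdd l i))) * G fun j => v (σ (Fin.natAdd k j))) := by
  rw [wedgeMul, wedge_apply]
  simp only [ContinuousLinearMap.mul_apply', hα, hβ]
  rw [sum_sign_smul_mul_sum_sign_smul F G v, ← Nat.cast_smul_eq_nsmul ℝ, smul_smul]
  push_cast
  rw [inv_mul_cancel₀ (by positivity), one_smul]

/-- The position `2 i` among `2 p`. -/
def evenPos {p : ℕ} (i : Fin p) : Fin (2 * p) := ⟨2 * i, by omega⟩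

/-- The position `2 i + 1` among `2 p`. -/
def oddPos {p : ℕ} (i : Fin p) : Fin (2 * p) := ⟨2 * i + 1, by omega⟩

theorem ofFn_prod_succ_last {A : Type*} [Monoid A] {p : ℕ} (f : Fin (p + 1) → A) :
    (List.ofFn f).prod = (List.ofFn fun i : Fin p => f i.castSucc).prod * f (Fin.last p) := by
  rw [List.ofFn_succ', List.concat_eq_append, List.prod_append, List.prod_singleton]

/-- Working with a non-antisymmetric b whose antisymmetrization is Ω keeps the expansion of Ω^p free
of factors: all the factorials of the successive wedges cancel. -/
theorem wedgePow_apply {Ω : E → E [⋀^Fin 2]→L[ℝ] Mat n} {x : E} {b : E → E → Mat n}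
    (hb : ∀ v, Ω x v = b (v 0) (v 1) - b (v 1) (v 0)) (p : ℕ) (v : Fin (2 * p) → E) :
    wedgePow Ω p x v = ∑ σ : Equiv.Perm (Fin (2 * p)), Equiv.Perm.sign σ •
      (List.ofFn fun i : Fin p => b (v (σ (evenPos i))) (v (σ (oddPos i)))).prod := by
  induction p with
  | zero => simp [wedgePow, oneZeroForm]
  | succ p ih =>
    have h2 : ∀ v : Fin 2 → E, Ω x v = ∑ π : Equiv.Perm (Fin 2), Equiv.Perm.sign π •
        (fun w : Fin 2 → E => b (w 0) (w 1)) fun i => v (π i) := by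
      intro v
      rw [show (Finset.univ : Finset (Equiv.Perm (Fin 2))) = {1, Equiv.swap 0 1} by decide,
        Finset.sum_pair (by decide), hb]
      simp [sub_eq_add_neg]
    rw [wedgePow, wedgeMul_apply_of_antisymm (k := 2 * p) (l := 2)
      (F := fun w => (List.ofFn fun i : Fin p => b (w (evenPos i)) (w (oddPos i))).prod)
      (G := fun w => b (w 0) (w 1)) ih h2 v]
    refine Finset.sum_congr rfl fun σ _ => ?_
    rw [ofFn_prod_succ_last]
    rfl

theorem wedgeProd_apply {k : ℕ} (α : Fin k → E → E [⋀^Fin 1]→L[ℝ] Mat n) (x : E)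
    (v : Fin k → E) :
    wedgeProd α x v = ∑ σ : Equiv.Perm (Fin k), Equiv.Perm.sign σ •
      (List.ofFn fun i : Fin k => α i x fun _ => v (σ i)).prod := by
  induction k with
  | zero => simp [wedgeProd, oneZeroForm]
  | succ k ih =>
    rw [wedgeProd, wedgeMul_apply_of_antisymm (k := k) (l := 1)
      (F := fun w => (List.ofFn fun i : Fin k => α i.castSucc x fun _ => w i).prod)
      (G := fun w => α (Fin.last k) x fun _ => w 0) (fun w => ih _ w)
      (fun w => by simp; congr; funext i; congr 1; exact Subsingleton.elim _ _) v]
    refine Finset.sum_congr rfl fun σ _ => ?_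
    rw [ofFn_prod_succ_last]
    rfl

theorem trace_mul_comm (a b : Mat n) : trace n (a * b) = trace n (b * a) :=
  Matrix.trace_mul_comm (R := ℂ) a b

theorem ofFn_prod_conj {A : Type*} [Monoid A] {p : ℕ} (f : Fin p → A) {c d : A} (hcd : d * c = 1)
    (hdc : c * d = 1) :
    (List.ofFn fun i => c * f i * d).prod = c * (List.ofFn f).prod * d := by
  induction p with
  | zero => simp [hdc]
  | succ p ih =>
    rw [ofFn_prod_succ_last, ih, ofFn_prod_succ_last f]
    simp only [mul_assoc]
    rw [← mul_assoc d c, hcd, one_mul]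

theorem trace_conj (a : Mat n) {c d : Mat n} (hcd : d * c = 1) :
    trace n (c * a * d) = trace n a := by
  rw [trace_mul_comm, ← mul_assoc, hcd, one_mul]

theorem trace_units_smul (u : ℤˣ) (a : Mat n) : trace n (u • a) = u • trace n a := by
  rcases Int.units_eq_one_or u with rfl | rfl <;> simp

end Values

/-! ### Antisymmetrizations in two families of vectors -/

section TwoFamilies

/-- The enumeration of `2 p` positions as pairs. -/
def pairPos (p : ℕ) : Fin p ⊕ Fin p ≃ Fin (2 * p) :=
  Equiv.ofBijective (Sum.elim evenPos oddPos) <| by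
    rw [Fintype.bijective_iff_injective_and_card]
    refine ⟨?_, by simp [two_mul]⟩
    rintro (i | i) (j | j) h <;> simp [evenPos, oddPos, Fin.ext_iff] at h ⊢ <;> omega

/-- The enumeration of `2 p` positions as two blocks. -/
def blockPos (p : ℕ) : Fin p ⊕ Fin p ≃ Fin (2 * p) :=
  finSumFinEquiv.trans (finCongr (two_mul p).symm)

@[simp] theorem pairPos_inl {p : ℕ} (i : Fin p) : pairPos p (Sum.inl i) = evenPos i := rfl
@[simp] theorem pairPos_inr {p : ℕ} (i : Fin p) : pairPos p (Sum.inr i) = oddPos i := rfl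

/-- The sign of the shuffle that interleaves two blocks of length `p`. -/
theorem sign_blockPos_symm_trans_pairPos (p : ℕ) :
    Equiv.Perm.sign ((blockPos p).symm.trans (pairPos p)) = (-1) ^ (p * (p - 1) / 2) := by
  have h : Equiv.Perm.sign ((blockPos p).symm.trans (pairPos p)) =
      Equiv.Perm.sign ((finSumFinEquiv (m := p) (n := p)).symm.trans
        ((pairPos p).trans (finCongr (two_mul p)))) := by
    rw [← Equiv.Perm.sign_permCongr (finCongr (two_mul p))]
    congr 1
  rw [h]
  set s : Equiv.Perm (Fin (p + p)) := (finSumFinEquiv (m := p) (n := p)).symm.trans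
        ((pairPos p).trans (finCongr (two_mul p))) with hs
  have hl : ∀ i : Fin p, (s (Fin.castAdd p i) : ℕ) = 2 * i := by
    intro i; simp [hs, evenPos]
  have hr : ∀ i : Fin p, (s (Fin.natAdd p i) : ℕ) = 2 * i + 1 := by
    intro i
    simp only [hs, Equiv.trans_apply, finSumFinEquiv_symm_apply_natAdd, pairPos_inr, oddPos]
    simp
  -- The sign is computed by counting inversions. As s sends the two blocks increasingly to the even
  -- and to the odd positions, the only inversions pair i in the first block with j < i in the
  -- second, and there are 0 + 1 + ⋯ + (p - 1) of them.
  have hI : ∀ j : Fin (p + p), ∏ i ∈ Finset.Iio j, (if s i < s j then 1 else -1 : ℤˣ) =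
      ∏ i, if i < j ∧ s j ≤ s i then -1 else 1 := by
    intro j
    rw [show Finset.Iio j = Finset.univ.filter (· < j) by ext; simp, Finset.prod_filter]
    refine Finset.prod_congr rfl fun i _ => ?_
    by_cases h1 : i < j <;> by_cases h2 : s i < s j <;> simp [h1, h2, not_le.mpr, not_lt.mp]
  have hc : ∀ i : Fin p, ∏ j : Fin p, (if j < i then -1 else 1 : ℤˣ) = (-1) ^ (i : ℕ) := by
    intro i
    rw [Finset.prod_ite, Finset.prod_const_one, mul_one, Finset.prod_const,
      show Finset.univ.filter (· < i) = Finset.Iio i by ext; simp, Fin.card_Iio]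
  rw [Equiv.Perm.sign_eq_prod_prod_Iio, Fin.prod_univ_add]
  simp only [hI]
  simp only [Fin.prod_univ_add, Fin.lt_def, Fin.le_def, hl, hr, Fin.val_castAdd, Fin.val_natAdd]
  rw [Finset.prod_eq_one fun j _ => ?_, one_mul]
  · have h1 : ∀ j : Fin p, (∏ i : Fin p, if (i : ℕ) < p + j ∧ 2 * (j : ℕ) + 1 ≤ 2 * i then
        (-1 : ℤˣ) else 1) = ∏ i : Fin p, if j < i then -1 else 1 := fun j =>
      Finset.prod_congr rfl fun i _ => if_congr (by rw [Fin.lt_def]; omega) rfl rfl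
    have h2 : ∀ j : Fin p, (∏ i : Fin p, if p + (i : ℕ) < p + j ∧ 2 * (j : ℕ) + 1 ≤ 2 * i + 1 then
        (-1 : ℤˣ) else 1) = 1 := fun j =>
      Finset.prod_eq_one fun i _ => if_neg (by omega)
    simp only [h1, h2, mul_one]
    rw [Finset.prod_comm, Finset.prod_congr rfl fun i _ => hc i,
      Finset.prod_pow_eq_pow_sum, Fin.sum_univ_eq_sum_range (fun i => i), Finset.sum_range_id]
  · rw [Finset.prod_eq_one fun i _ => if_neg (by omega),
      Finset.prod_eq_one fun i _ => if_neg (by omega), one_mul]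

/-- The hypothesis forbids any e in a second slot; as there are as many second slots as v's, only
the σ that send first slots to e's and second slots to v's survive. -/
theorem sum_sign_smul_pairs {E A : Type*} [Ring A] {p : ℕ} (b : E → E → A) (e v : Fin p → E)
    (hb : ∀ x i, b x (e i) = 0) :
    ∑ σ : Equiv.Perm (Fin (2 * p)), Equiv.Perm.sign σ • (List.ofFn fun i : Fin p =>
        b (Fin.append e v (Fin.cast (two_mul p) (σ (evenPos i))))
          (Fin.append e v (Fin.cast (two_mul p) (σ (oddPos i))))).prod =
      ((-1) ^ (p * (p - 1) / 2) : ℤˣ) • ∑ a : Equiv.Perm (Fin p), ∑ c : Equiv.Perm (Fin p),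
        (Equiv.Perm.sign a * Equiv.Perm.sign c) •
          (List.ofFn fun i : Fin p => b (e (a i)) (v (c i))).prod := by
  have hw : ∀ z, Fin.append e v (Fin.cast (two_mul p) (blockPos p z)) = Sum.elim e v z := by
    rintro (i | i)
    · simp [blockPos]
    · simp only [blockPos, Equiv.trans_apply, finSumFinEquiv_apply_right, finCongr_apply,
        Fin.cast_cast, Fin.cast_eq_self, Fin.append_right, Sum.elim_inr]
  -- A permutation is read with its source labelled by slots (first or second of a pair) and its
  -- target by blocks (e or v). The two labellings differ by the interleaving shuffle, hence the
  -- constant sign in `hsign`.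
  let re : Equiv.Perm (Fin p ⊕ Fin p) ≃ Equiv.Perm (Fin (2 * p)) :=
    (Equiv.equivCongr (pairPos p) (blockPos p))
  have hre : ∀ τ z, re τ (pairPos p z) = blockPos p (τ z) := by
    intro τ z; simp [re]
  have hsign : ∀ τ, Equiv.Perm.sign (re τ) =
      (-1) ^ (p * (p - 1) / 2) * Equiv.Perm.sign τ := by
    intro τ
    rw [← sign_blockPos_symm_trans_pairPos, ← Equiv.Perm.sign_permCongr (blockPos p) τ]
    have : re τ = (blockPos p).permCongr τ * ((blockPos p).symm.trans (pairPos p))⁻¹ := by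
      ext x
      obtain ⟨z, rfl⟩ := (pairPos p).surjective x
      simp [hre, Equiv.Perm.inv_def, Equiv.permCongr_apply]
    rw [this, map_mul, map_inv, Int.units_inv_eq_self, mul_comm]
  rw [← re.sum_comp, ← Fintype.sum_prod_type', Finset.smul_sum]
  symm
  refine Fintype.sum_of_injective (Equiv.Perm.sumCongrHom (Fin p) (Fin p))
    Equiv.Perm.sumCongrHom_injective _ _ (fun τ hτ => ?_) fun ac => ?_
  -- A τ outside the image of `sumCongrHom` does not preserve the left summand, hence not the right
  -- one either: some second slot receives an e and its factor is zero.
  · have : ¬ Set.MapsTo τ (Set.range Sum.inl) (Set.range Sum.inl) := fun h =>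
      hτ (Equiv.Perm.mem_sumCongrHom_range_of_perm_mapsTo_inl h)
    rw [Equiv.Perm.perm_mapsTo_inl_iff_mapsTo_inr] at this
    obtain ⟨i, hi⟩ : ∃ i, τ (Sum.inr i) ∉ Set.range Sum.inr := by
      by_contra! hc
      exact this (by rintro _ ⟨i, rfl⟩; exact hc i)
    obtain ⟨j, hj⟩ : ∃ j, τ (Sum.inr i) = Sum.inl j := by
      rcases hx : τ (Sum.inr i) with j | j
      · exact ⟨j, rfl⟩
      · exact absurd ⟨j, hx.symm⟩ hi
    rw [List.prod_eq_zero, smul_zero]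
    rw [List.mem_ofFn]
    refine ⟨i, ?_⟩
    simp only [← pairPos_inr, hre, hw]
    rw [hj, Sum.elim_inl, hb]
  · rw [hsign]
    simp only [← pairPos_inr, ← pairPos_inl, hre, hw]
    simp [smul_smul]

/-- The left side is an alternating multilinear function of the p rows of M, with values in a
possibly noncommutative algebra; such a function on ℝ^p is the determinant times its value at the
identity matrix. -/
theorem sum_sign_smul_linearCombination {A : Type*} [Ring A] [Algebra ℝ A] {p : ℕ}
    (M : Matrix (Fin p) (Fin p) ℝ) (X : Fin p → Fin p → A) (c : Fin p → Fin p) :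
    ∑ a : Equiv.Perm (Fin p), Equiv.Perm.sign a •
        (List.ofFn fun i : Fin p => ∑ s, M (a i) s • X s (c i)).prod =
      M.det • ∑ a : Equiv.Perm (Fin p), Equiv.Perm.sign a •
        (List.ofFn fun i : Fin p => X (a i) (c i)).prod := by
  let f : (Fin p → ℝ) [⋀^Fin p]→ₗ[ℝ] A := MultilinearMap.alternatization
    ((MultilinearMap.mkPiAlgebraFin ℝ p A).compLinearMap fun i =>
      ∑ s, (LinearMap.proj (R := ℝ) (φ := fun _ : Fin p => ℝ) s).smulRight (X s (c i)))
  have hf : ∀ M : Fin p → Fin p → ℝ, f M = ∑ a : Equiv.Perm (Fin p), Equiv.Perm.sign a •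
        (List.ofFn fun i : Fin p => ∑ s, M (a i) s • X s (c i)).prod := by
    intro M
    simp [f, MultilinearMap.alternatization_apply]
  let I : Fin p → Fin p → ℝ := fun i => Pi.basisFun ℝ (Fin p) i
  have hI : Matrix.det (Matrix.of I) = 1 := by
    rw [← Matrix.det_one (n := Fin p) (R := ℝ)]
    congr 1
    ext i j
    simp [I, Matrix.one_apply, Pi.single_apply, eq_comm]
  have key : f = (LinearMap.toSpanSingleton ℝ A (f I)).compAlternatingMap
      Matrix.detRowAlternating := by
    refine Module.Basis.ext_alternating (Pi.basisFun ℝ (Fin p)) fun v hv => ?_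
    let e : Equiv.Perm (Fin p) := Equiv.ofBijective v (Finite.injective_iff_bijective.mp hv)
    have h1 : (fun i => Pi.basisFun ℝ (Fin p) (v i)) = I ∘ e := rfl
    rw [h1, AlternatingMap.map_perm, AlternatingMap.map_perm]
    congr 1
    change _ = Matrix.det (Matrix.of I) • f I
    rw [hI, one_smul]
  have h1 : f I = ∑ a : Equiv.Perm (Fin p), Equiv.Perm.sign a •
        (List.ofFn fun i : Fin p => X (a i) (c i)).prod := by
    rw [hf]
    simp [I, Pi.single_apply]
  rw [← h1]
  refine (hf M).symm.trans ?_
  conv_lhs => rw [key]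
  rfl

/-- Rotating a and c simultaneously changes neither the trace nor the product of the signs. Every a
is uniquely a permutation fixing 0 preceded by one of the m + 1 rotations, so it suffices to sum
over those with a 0 = 0. -/
theorem sum_sign_trace_eq {n m : ℕ} (X : Fin (m + 1) → Fin (m + 1) → Mat n) :
    ∑ a : Equiv.Perm (Fin (m + 1)), ∑ c : Equiv.Perm (Fin (m + 1)),
        (Equiv.Perm.sign a * Equiv.Perm.sign c) •
          trace n (List.ofFn fun i => X (a i) (c i)).prod =
      (m + 1) • ∑ σ : Equiv.Perm (Fin m), ∑ c : Equiv.Perm (Fin (m + 1)),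
        (Equiv.Perm.sign σ * Equiv.Perm.sign c) •
          trace n (X 0 (c 0) * (List.ofFn fun j : Fin m => X (σ j).succ (c j.succ)).prod) := by
  set S : Equiv.Perm (Fin (m + 1)) → ℂ := fun a => ∑ c : Equiv.Perm (Fin (m + 1)),
        (Equiv.Perm.sign a * Equiv.Perm.sign c) •
          trace n (List.ofFn fun i => X (a i) (c i)).prod with hS
  have h1 : ∀ a, S (a * Equiv.addRight 1) = S a := by
    intro a
    simp only [hS]
    rw [← Equiv.sum_comp (Equiv.mulRight (Equiv.addRight (1 : Fin (m + 1))))]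
    refine Finset.sum_congr rfl fun c _ => ?_
    rw [Equiv.coe_mulRight, map_mul, map_mul, mul_mul_mul_comm, Int.units_mul_self, mul_one]
    congr 1
    rw [ofFn_prod_succ_last, List.ofFn_succ, List.prod_cons, trace_mul_comm]
    simp
  have h3 : ∀ k a, S (a * Equiv.addRight k) = S a := by
    intro k
    induction k using Fin.induction with
    | zero => intro a; congr 1; ext; simp
    | succ k ih =>
      intro a
      rw [← ih a, ← h1 (a * Equiv.addRight k.castSucc)]
      congr 1
      ext x
      simp [← Fin.coeSucc_eq_succ, add_assoc, add_comm (1 : Fin (m + 1)) k.castSucc]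
  let u : Fin (m + 1) × Equiv.Perm (Fin m) → Equiv.Perm (Fin (m + 1)) := fun x =>
    Equiv.Perm.decomposeFin.symm (0, x.2) * Equiv.addRight x.1
  have hu : Function.Bijective u := by
    rw [Fintype.bijective_iff_injective_and_card]
    refine ⟨?_, by simp [Fintype.card_perm, Nat.factorial_succ]⟩
    rintro ⟨k, σ⟩ ⟨k', σ'⟩ h
    have hk : k = k' := by
      -- The rotation index is recovered from the point that the permutation sends to 0, namely -k.
      have := DFunLike.congr_fun h (-k)
      simp only [u, Equiv.Perm.mul_apply, Equiv.coe_addRight, neg_add_cancel,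
        Equiv.Perm.decomposeFin_symm_apply_zero] at this
      have h0 : (0 : Fin (m + 1)) = -k + k' := by
        apply (Equiv.Perm.decomposeFin.symm (0, σ')).injective
        rw [← this, Equiv.Perm.decomposeFin_symm_apply_zero]
      rw [eq_comm, neg_add_eq_zero] at h0
      exact h0
    subst hk
    have := Equiv.Perm.decomposeFin.symm.injective (mul_right_cancel h)
    simp_all
  rw [← hu.sum_comp S, Fintype.sum_prod_type]
  have h4 : ∀ k σ, S (u (k, σ)) = S (Equiv.Perm.decomposeFin.symm (0, σ)) := fun k σ => h3 _ _
  simp only [h4]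
  rw [Finset.sum_const, Finset.card_univ, Fintype.card_fin]
  congr 1
  refine Finset.sum_congr rfl fun σ _ => Finset.sum_congr rfl fun c _ => ?_
  rw [List.ofFn_succ, List.prod_cons, Equiv.Perm.decomposeFin.symm_sign]
  simp

end TwoFamilies

/-! ### The volume of the simplex -/

section Volume

open MeasureTheory

theorem mem_simplex_iff {q : ℕ} {t : Fin q → ℝ} :
    t ∈ simplex q ↔ (∀ i, 0 ≤ t i) ∧ ∑ i, t i ≤ 1 := by
  simp only [simplex, stdSimplex, Set.mem_ofPred_eq, bary, Fin.forall_fin_succ, Fin.cons_zero,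
    Fin.cons_succ, Fin.sum_univ_succ, sub_add_cancel, and_true, sub_nonneg]
  exact and_comm

theorem measurableSet_nonneg_sum_le (q : ℕ) (r : ℝ) :
    MeasurableSet {t : Fin q → ℝ | (∀ i, 0 ≤ t i) ∧ ∑ i, t i ≤ r} := by
  refine IsClosed.measurableSet ?_
  simp only [Set.ofPred_and, Set.ofPred_forall]
  exact (isClosed_iInter fun i => isClosed_le continuous_const (continuous_apply i)).inter
    (isClosed_le (by fun_prop) continuous_const)

/-- Induction on q by slicing along the first coordinate: the slice at s is the same region with
bound r - s, which is why r has to vary. -/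
theorem volume_nonneg_sum_le (q : ℕ) {r : ℝ} (hr : 0 ≤ r) :
    volume {t : Fin q → ℝ | (∀ i, 0 ≤ t i) ∧ ∑ i, t i ≤ r} =
      ENNReal.ofReal (r ^ q / q.factorial) := by
  induction q generalizing r with
  | zero => simp [hr, volume_pi]
  | succ q ih =>
    have hmp := volume_preserving_piFinSuccAbove (fun _ : Fin (q + 1) => ℝ) 0
    set S : Set (ℝ × (Fin q → ℝ)) :=
      {x | 0 ≤ x.1 ∧ (∀ i, 0 ≤ x.2 i) ∧ x.1 + ∑ i, x.2 i ≤ r} with hS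
    have hSm : MeasurableSet S := by
      refine IsClosed.measurableSet ?_
      simp only [hS, Set.ofPred_and, Set.ofPred_forall]
      exact (isClosed_le continuous_const (by fun_prop)).inter
        ((isClosed_iInter fun i => isClosed_le continuous_const (by fun_prop)).inter
          (isClosed_le (by fun_prop) continuous_const))
    have hpre : {t : Fin (q + 1) → ℝ | (∀ i, 0 ≤ t i) ∧ ∑ i, t i ≤ r} =
        MeasurableEquiv.piFinSuccAbove (fun _ : Fin (q + 1) => ℝ) 0 ⁻¹' S := by
      ext t
      simp only [hS, Set.mem_ofPred_eq, Set.mem_preimage, Fin.forall_fin_succ, Fin.sum_univ_succ,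
        and_assoc]
      rfl
    rw [hpre, hmp.measure_preimage hSm.nullMeasurableSet, Measure.volume_eq_prod,
      Measure.prod_apply hSm]
    have hslice : ∀ s : ℝ, volume (Prod.mk s ⁻¹' S) =
        (Set.Icc 0 r).indicator (fun s => ENNReal.ofReal ((r - s) ^ q / q.factorial)) s := by
      intro s
      by_cases hs : s ∈ Set.Icc 0 r
      · rw [Set.indicator_of_mem hs, ← ih (sub_nonneg.mpr hs.2)]
        congr 1
        ext t
        simp only [hS, Set.mem_preimage, Set.mem_ofPred_eq, hs.1, true_and, le_sub_iff_add_le']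
      · rw [Set.indicator_of_notMem hs]
        convert measure_empty (μ := (volume : Measure (Fin q → ℝ)))
        rw [Set.eq_empty_iff_forall_notMem]
        rintro t ⟨h0, h1, h2⟩
        refine hs ⟨h0, ?_⟩
        have : 0 ≤ ∑ i, t i := Finset.sum_nonneg fun i _ => h1 i
        dsimp only at h2
        linarith
    simp_rw [hslice]
    rw [lintegral_indicator measurableSet_Icc, ← ofReal_integral_eq_lintegral_ofReal,
      integral_Icc_eq_integral_Ioc, ← intervalIntegral.integral_of_le hr]
    · congr 1
      rw [intervalIntegral.integral_comp_sub_left (fun s => s ^ q / (q.factorial : ℝ)) r,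
        intervalIntegral.integral_div, integral_pow, Nat.factorial_succ]
      push_cast
      field_simp
      simp
    · exact Continuous.integrableOn_Icc (by fun_prop)
    · filter_upwards [ae_restrict_mem measurableSet_Icc] with s hs
      have := sub_nonneg.mpr hs.2
      positivity

theorem measurableSet_simplex (q : ℕ) : MeasurableSet (simplex q) := by
  have : simplex q = {t : Fin q → ℝ | (∀ i, 0 ≤ t i) ∧ ∑ i, t i ≤ 1} := by
    ext t; exact mem_simplex_iff
  rw [this]
  exact measurableSet_nonneg_sum_le q 1

theorem volume_real_simplex (q : ℕ) : volume.real (simplex q) = 1 / q.factorial := by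
  have : simplex q = {t : Fin q → ℝ | (∀ i, 0 ≤ t i) ∧ ∑ i, t i ≤ 1} := by
    ext t; exact mem_simplex_iff
  rw [measureReal_def, this, volume_nonneg_sum_le q zero_le_one, one_pow,
    ENNReal.toReal_ofReal (by positivity)]

end Volume

/-! ### The curvature of the canonical connection -/

instance (n : ℕ) : FiniteDimensional ℝ (Mat n) := FiniteDimensional.complexToReal (Mat n)

instance (n : ℕ) : CompleteSpace (Mat n) := FiniteDimensional.complete ℂ (Mat n)

section Curvature

variable {n q : ℕ}

/-- The derivative of the barycentric coordinates in the direction `τ`. -/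
def baryDir (τ : Fin q → ℝ) : Fin (q + 1) → ℝ :=
  Fin.cons (-∑ i, τ i) τ

theorem sum_bary (t : Fin q → ℝ) : ∑ i, bary t i = 1 := by
  simp [bary, Fin.sum_univ_succ]

theorem sum_baryDir (τ : Fin q → ℝ) : ∑ i, baryDir τ i = 0 := by
  simp [baryDir, Fin.sum_univ_succ]

theorem hasFDerivAt_bary (t : Fin q → ℝ) (i : Fin (q + 1)) :
    ∃ L : (Fin q → ℝ) →L[ℝ] ℝ, (∀ τ, L τ = baryDir τ i) ∧ HasFDerivAt (fun t => bary t i) L t := by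
  refine Fin.cases ?_ (fun j => ?_) i
  · refine ⟨-∑ i, ContinuousLinearMap.proj (R := ℝ) (φ := fun _ : Fin q => ℝ) i,
      fun τ => by simp [baryDir], ?_⟩
    have h : HasFDerivAt (fun t : Fin q → ℝ => ∑ i, t i)
        (∑ i, ContinuousLinearMap.proj (R := ℝ) (φ := fun _ : Fin q => ℝ) i) t :=
      HasFDerivAt.fun_sum fun i _ => hasFDerivAt_apply i t
    exact h.const_sub 1
  · exact ⟨ContinuousLinearMap.proj (R := ℝ) (φ := fun _ : Fin q => ℝ) j,
      fun τ => by simp [baryDir], hasFDerivAt_apply j t⟩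

/-- The values of the forms `θ_i = g_i⁻¹ dg_i` at `g` on a tangent vector. -/
def logDeriv (g ξ : Fin (q + 1) → Mat n) : Fin (q + 1) → Mat n :=
  fun i => Ring.inverse (g i) * ξ i

/-- A bilinear expression whose antisymmetrization is the curvature, in terms of the values `a`
and `a'` of the forms `θ_i` on the two tangent vectors. -/
def curvCoeff (t τ : Fin q → ℝ) (a a' : Fin (q + 1) → Mat n) : Mat n :=
  ∑ i, baryDir τ i • a' i - ∑ i, bary t i • (a i * a' i) +
    (∑ i, bary t i • a i) * ∑ i, bary t i • a' i

theorem hasFDerivAt_clm_comp {E F G : Type*} [NormedAddCommGroup E] [NormedSpace ℝ E]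
    [NormedAddCommGroup F] [NormedSpace ℝ F] [NormedAddCommGroup G] [NormedSpace ℝ G]
    (L : F →L[ℝ] G) {f : E → F} {f' : E →L[ℝ] F} {x : E} (hf : HasFDerivAt f f' x) :
    HasFDerivAt (fun y => L (f y)) (L.comp f') x := by
  have hL : HasFDerivAt L L (f x) := L.hasFDerivAt
  exact hL.comp x hf

theorem extDeriv_oneForm_apply {E F : Type*} [NormedAddCommGroup E] [NormedSpace ℝ E]
    [NormedAddCommGroup F] [NormedSpace ℝ F] {c : E → E →L[ℝ] F} {c' : E →L[ℝ] E →L[ℝ] F} {x : E}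
    (hc : HasFDerivAt c c' x) (v : Fin 2 → E) :
    extDeriv (oneForm c) x v = c' (v 0) (v 1) - c' (v 1) (v 0) := by
  let L : (E →L[ℝ] F) →L[ℝ] E [⋀^Fin 1]→L[ℝ] F :=
    (ContinuousAlternatingMap.ofSubsingletonLIE (𝕜 := ℝ) (E := E) (F := F)
      (0 : Fin 1)).toContinuousLinearEquiv
  have h : HasFDerivAt (oneForm c) (L.comp c') x := hasFDerivAt_clm_comp L hc
  rw [extDeriv, h.fderiv, ContinuousAlternatingMap.alternatizeUncurryFin_apply]
  simp [Fin.sum_univ_succ, Fin.removeNth, L, sub_eq_add_neg]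

theorem hasFDerivAt_ringInverse_apply {E A : Type*} [NormedAddCommGroup E] [NormedSpace ℝ E]
    [NormedRing A] [NormedAlgebra ℝ A] [CompleteSpace A]
    {f : E → A} {f' : E →L[ℝ] A} {x : E} (hf : HasFDerivAt f f' x) (hx : IsUnit (f x)) :
    HasFDerivAt (fun y => Ring.inverse (f y))
      (-(ContinuousLinearMap.mulLeftRight ℝ A (Ring.inverse (f x))
        (Ring.inverse (f x))).comp f') x := by
  obtain ⟨u, hu⟩ := hx
  have h := hasFDerivAt_ringInverse (𝕜 := ℝ) u
  rw [hu] at h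
  have := h.comp x hf
  rw [← hu, Ring.inverse_unit]
  exact this

theorem connection_apply (t : Fin q → ℝ) (g : Fin (q + 1) → Mat n)
    (v : Fin 1 → (Fin q → ℝ) × (Fin (q + 1) → Mat n)) :
    connection n q (t, g) v = ∑ i, bary t i • logDeriv g (v 0).2 i := by
  have h : ∀ i, fderiv ℝ (fun y : (Fin q → ℝ) × (Fin (q + 1) → Mat n) => y.2 i) (t, g) =
      (ContinuousLinearMap.proj (R := ℝ) (φ := fun _ : Fin (q + 1) => Mat n) i).comp
        (ContinuousLinearMap.snd ℝ _ _) := fun i =>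
    ((ContinuousLinearMap.proj (R := ℝ) (φ := fun _ : Fin (q + 1) => Mat n) i).comp
        (ContinuousLinearMap.snd ℝ (Fin q → ℝ) (Fin (q + 1) → Mat n))).fderiv
  simp [connection, pullback, maurerCartan, oneForm, h, logDeriv]

/-- The second term comes from d(g⁻¹) = -g⁻¹ dg g⁻¹; after antisymmetrization it is the
Maurer–Cartan equation. -/
theorem hasFDerivAt_sum_bary_smul_inverse {A : Type*} [NormedRing A] [NormedAlgebra ℝ A]
    [CompleteSpace A] (t : Fin q → ℝ) {g : Fin (q + 1) → A} (hg : ∀ i, IsUnit (g i)) :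
    ∃ c' : (Fin q → ℝ) × (Fin (q + 1) → A) →L[ℝ] (Fin q → ℝ) × (Fin (q + 1) → A) →L[ℝ] A,
      HasFDerivAt (fun x : (Fin q → ℝ) × (Fin (q + 1) → A) =>
        ∑ i, bary x.1 i • (ContinuousLinearMap.mul ℝ A (Ring.inverse (x.2 i))).comp
          ((ContinuousLinearMap.proj (R := ℝ) (φ := fun _ : Fin (q + 1) => A) i).comp
            (ContinuousLinearMap.snd ℝ _ _))) c' (t, g) ∧
      ∀ u w, c' u w = ∑ i, (baryDir u.1 i • (Ring.inverse (g i) * w.2 i) -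
        bary t i • (Ring.inverse (g i) * u.2 i * (Ring.inverse (g i) * w.2 i))) := by
  choose β hβ hβ' using hasFDerivAt_bary (q := q) t
  have hβ'' : ∀ i, HasFDerivAt (fun x : (Fin q → ℝ) × (Fin (q + 1) → A) => bary x.1 i)
      ((β i).comp (ContinuousLinearMap.fst ℝ _ _)) (t, g) :=
    fun i => HasFDerivAt.comp (g := fun t => bary t i) (t, g) (hβ' i) hasFDerivAt_fst
  let P : Fin (q + 1) → (Fin q → ℝ) × (Fin (q + 1) → A) →L[ℝ] A := fun i =>
    (ContinuousLinearMap.proj (R := ℝ) (φ := fun _ : Fin (q + 1) => A) i).comp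
            (ContinuousLinearMap.snd ℝ _ _)
  have hP : ∀ i, HasFDerivAt (fun x : (Fin q → ℝ) × (Fin (q + 1) → A) => x.2 i) (P i) (t, g) :=
    fun i => (P i).hasFDerivAt
  have hK := fun i => hasFDerivAt_clm_comp
    (((ContinuousLinearMap.compL ℝ _ A A).flip (P i)).comp (ContinuousLinearMap.mul ℝ A))
    (hasFDerivAt_ringInverse_apply (hP i) (hg i))
  refine ⟨_, HasFDerivAt.fun_sum fun i _ => (hβ'' i).smul (hK i), fun u w => ?_⟩
  simp only [sum_apply]
  refine Finset.sum_congr rfl fun i _ => ?_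
  simp [P, hβ, mul_assoc]
  abel

theorem connection_eq_oneForm : connection n q = oneForm fun x =>
    ∑ i, bary x.1 i • (ContinuousLinearMap.mul ℝ (Mat n) (Ring.inverse (x.2 i))).comp
      ((ContinuousLinearMap.proj (R := ℝ) (φ := fun _ : Fin (q + 1) => Mat n) i).comp
        (ContinuousLinearMap.snd ℝ _ _)) := by
  ext x v
  rw [connection_apply]
  simp [oneForm, logDeriv]

theorem extDeriv_connection_apply (t : Fin q → ℝ) {g : Fin (q + 1) → Mat n} (hg : g ∈ NGbar n q)
    (v : Fin 2 → (Fin q → ℝ) × (Fin (q + 1) → Mat n)) :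
    extDeriv (connection n q) (t, g) v =
      ∑ i, (baryDir (v 0).1 i • logDeriv g (v 1).2 i -
          bary t i • (logDeriv g (v 0).2 i * logDeriv g (v 1).2 i)) -
        ∑ i, (baryDir (v 1).1 i • logDeriv g (v 0).2 i -
          bary t i • (logDeriv g (v 1).2 i * logDeriv g (v 0).2 i)) := by
  obtain ⟨c', hc, hc'⟩ := hasFDerivAt_sum_bary_smul_inverse t hg
  rw [connection_eq_oneForm, extDeriv_oneForm_apply hc, hc', hc']
  rfl

theorem curvature_apply (t : Fin q → ℝ) {g : Fin (q + 1) → Mat n} (hg : g ∈ NGbar n q)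
    (v : Fin 2 → (Fin q → ℝ) × (Fin (q + 1) → Mat n)) :
    curvature n q (t, g) v =
      curvCoeff t (v 0).1 (logDeriv g (v 0).2) (logDeriv g (v 1).2) -
        curvCoeff t (v 1).1 (logDeriv g (v 1).2) (logDeriv g (v 0).2) := by
  -- For a 1-form the bracket product counts θ ∧ θ twice; this factor 2 cancels the ½ in the
  -- curvature.
  have hLie : wedgeLie (connection n q) (connection n q) (t, g) v =
      (2 : ℝ) • ((∑ i, bary t i • logDeriv g (v 0).2 i) * (∑ i, bary t i • logDeriv g (v 1).2 i) -
        (∑ i, bary t i • logDeriv g (v 1).2 i) * (∑ i, bary t i • logDeriv g (v 0).2 i)) := by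
    rw [wedgeLie, wedge_one_one_apply]
    simp only [connection_apply, sub_apply, ContinuousLinearMap.flip_apply,
      ContinuousLinearMap.mul_apply']
    rw [two_smul]
    abel
  rw [curvature, ContinuousAlternatingMap.add_apply, ContinuousAlternatingMap.smul_apply, hLie,
    extDeriv_connection_apply t hg, smul_smul]
  norm_num
  simp only [curvCoeff]
  abel

end Curvature

/-! ### The projection `γ` and the face maps -/

section Geometry

variable {n q : ℕ}

theorem hasFDerivAt_mul_inverse_pi {A : Type*} [NormedRing A] [NormedAlgebra ℝ A]
    [CompleteSpace A] {g : Fin (q + 1) → A} (hg : ∀ i, IsUnit (g i)) :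
    ∃ L : (Fin (q + 1) → A) →L[ℝ] Fin q → A,
      HasFDerivAt (fun (g : Fin (q + 1) → A) (j : Fin q) => g j.castSucc * Ring.inverse (g j.succ))
        L g ∧
      ∀ ξ j, L ξ j = ξ j.castSucc * Ring.inverse (g j.succ) -
        g j.castSucc * (Ring.inverse (g j.succ) * ξ j.succ * Ring.inverse (g j.succ)) := by
  have h : ∀ j : Fin q, HasFDerivAt
      (fun g : Fin (q + 1) → A => g j.castSucc * Ring.inverse (g j.succ)) _ g := fun j =>
    (hasFDerivAt_apply (𝕜 := ℝ) j.castSucc g).mul'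
      (hasFDerivAt_ringInverse_apply (hasFDerivAt_apply (𝕜 := ℝ) j.succ g) (hg j.succ))
  refine ⟨_, hasFDerivAt_pi.mpr h, fun ξ j => ?_⟩
  simp
  abel

theorem differentiableAt_gamma {g : Fin (q + 1) → Mat n} (hg : g ∈ NGbar n q) :
    DifferentiableAt ℝ gamma g := by
  obtain ⟨L, hL, -⟩ := hasFDerivAt_mul_inverse_pi hg
  exact hL.differentiableAt

theorem fderiv_gamma_apply {g : Fin (q + 1) → Mat n} (hg : g ∈ NGbar n q)
    (ξ : Fin (q + 1) → Mat n) (j : Fin q) :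
    fderiv ℝ gamma g ξ j = ξ j.castSucc * Ring.inverse (g j.succ) -
        g j.castSucc * (Ring.inverse (g j.succ) * ξ j.succ * Ring.inverse (g j.succ)) := by
  obtain ⟨L, hL, hL'⟩ := hasFDerivAt_mul_inverse_pi hg
  rw [← hL']
  exact congrFun (DFunLike.congr_fun hL.fderiv ξ) j

/-- The product (g_0 g_1⁻¹)(g_1 g_2⁻¹)⋯ telescopes. -/
theorem take_prod_gamma {g : Fin (q + 1) → Mat n} (hg : g ∈ NGbar n q) (k : ℕ) (hk : k < q + 1) :
    ((List.ofFn (gamma g)).take k).prod = g 0 * Ring.inverse (g ⟨k, hk⟩) := by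
  induction k with
  | zero => simp [Ring.mul_inverse_cancel _ (hg 0)]
  | succ k ih =>
    rw [List.prod_take_succ _ _ (by simp; omega), ih (by omega), List.getElem_ofFn, gamma, ← mul_assoc]
    congr 1
    rw [mul_assoc]
    simp [Ring.inverse_mul_cancel _ (hg _)]

theorem inverse_mul_inverse {A : Type*} [MonoidWithZero A] {a b : A} (ha : IsUnit a)
    (hb : IsUnit b) : Ring.inverse (a * Ring.inverse b) = b * Ring.inverse a := by
  obtain ⟨u, rfl⟩ := ha
  obtain ⟨w, rfl⟩ := hb
  rw [Ring.inverse_unit, Ring.inverse_unit, ← Units.val_mul, Ring.inverse_unit]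
  simp

theorem phi_apply (s : Fin q) (h : Fin q → Mat n) (v : Fin 1 → Fin q → Mat n) :
    phi s h v = ((List.ofFn h).take s).prod * v 0 s *
      Ring.inverse ((List.ofFn h).take (s + 1)).prod := by
  simp [phi, oneForm]

/-- Both partial products in φ_s telescope, and the derivative of g_s g_{s+1}⁻¹ (numbered from 0)
splits into the θ_s and θ_{s+1} terms. This links the φ_s to the connection. -/
theorem phi_gamma_fderiv_gamma {g : Fin (q + 1) → Mat n} (hg : g ∈ NGbar n q)
    (ξ : Fin (q + 1) → Mat n) (s : Fin q) :
    phi s (gamma g) (fun _ => fderiv ℝ gamma g ξ) =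
      g 0 * (logDeriv g ξ s.castSucc - logDeriv g ξ s.succ) * Ring.inverse (g 0) := by
  rw [phi_apply, take_prod_gamma hg s (by omega), take_prod_gamma hg (s + 1) (by omega),
    inverse_mul_inverse (hg _) (hg _), fderiv_gamma_apply hg]
  change g 0 * Ring.inverse (g s.castSucc) * _ * (g s.succ * _) = _
  have h1 := Ring.inverse_mul_cancel _ (hg s.castSucc)
  have h2 := Ring.inverse_mul_cancel _ (hg s.succ)
  simp only [logDeriv]
  generalize Ring.inverse (g s.castSucc) = x at *
  generalize Ring.inverse (g s.succ) = y at *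
  simp only [mul_sub, sub_mul, mul_assoc]
  congr 1
  · rw [← mul_assoc y, h2, one_mul]
  · rw [← mul_assoc y (g s.succ), h2, one_mul, ← mul_assoc x (g s.castSucc), h1, one_mul]

theorem exists_gamma_eq {h : Fin q → Mat n} (hh : h ∈ NG n q) :
    ∃ g ∈ NGbar n q, gamma g = h := by
  -- The section of γ normalized by g_0 = 1, obtained by solving g_j g_{j+1}⁻¹ = h_j recursively.
  let g : Fin (q + 1) → Mat n := fun i =>
    Fin.induction (motive := fun _ => Mat n) 1 (fun j x => Ring.inverse (h j) * x) i
  have h0 : g 0 = 1 := rfl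
  have hs : ∀ j : Fin q, g j.succ = Ring.inverse (h j) * g j.castSucc := fun j => rfl
  have hg : g ∈ NGbar n q := by
    intro i
    induction i using Fin.induction with
    | zero => rw [h0]; exact isUnit_one
    | succ j ih => rw [hs]; exact (isUnit_ringInverse.mpr (hh j)).mul ih
  refine ⟨g, hg, funext fun j => ?_⟩
  obtain ⟨u, hu⟩ := hg j.castSucc
  obtain ⟨w, hw⟩ := hh j
  rw [gamma, hs, ← hu, ← hw, Ring.inverse_unit, ← Units.val_mul, Ring.inverse_unit]
  simp

theorem fderiv_gamma_surjective {g : Fin (q + 1) → Mat n} (hg : g ∈ NGbar n q) :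
    Function.Surjective (fderiv ℝ gamma g) := by
  intro η
  -- The j-th component of the derivative is solved for ξ_{j+1} in terms of ξ_j and η_j, starting
  -- from ξ_0 = 0.
  let ξ : Fin (q + 1) → Mat n := fun i => Fin.induction (motive := fun _ => Mat n) 0 (fun j x =>
    g j.succ * Ring.inverse (g j.castSucc) * (x * Ring.inverse (g j.succ) - η j) * g j.succ) i
  have hs : ∀ j : Fin q, ξ j.succ = g j.succ * Ring.inverse (g j.castSucc) *
    (ξ j.castSucc * Ring.inverse (g j.succ) - η j) * g j.succ := fun j => rfl
  refine ⟨ξ, funext fun j => ?_⟩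
  rw [fderiv_gamma_apply hg, hs]
  obtain ⟨u, hu⟩ := hg j.castSucc
  obtain ⟨w, hw⟩ := hg j.succ
  rw [← hu, ← hw, Ring.inverse_unit, Ring.inverse_unit]
  simp [mul_assoc]

/-- Forgetting g_i for an inner i merges g_{i-1} g_i⁻¹ and g_i g_{i+1}⁻¹ into their product; for the
first or last i it drops a factor. -/
theorem face_gamma {g : Fin (q + 2) → Mat n} (hg : g ∈ NGbar n (q + 1)) (i : Fin (q + 2)) :
    face i (gamma g) = gamma (i.removeNth g) := by
  funext j
  simp only [face, gamma, Fin.removeNth]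
  rcases lt_trichotomy ((j : ℕ) + 1) i with h | h | h
  · rw [if_pos h, Fin.succAbove_of_castSucc_lt _ _ (by rw [Fin.lt_def]; simp; omega),
      Fin.succAbove_of_castSucc_lt _ _ (by rw [Fin.lt_def]; simp; omega)]
    rfl
  · rw [if_neg (by omega), if_pos h,
      Fin.succAbove_of_castSucc_lt _ _ (by rw [Fin.lt_def]; simp; omega),
      Fin.succAbove_of_le_castSucc _ _ (by rw [Fin.le_def]; simp; omega), mul_assoc,
      ← mul_assoc (Ring.inverse _)]
    rw [show j.succ.castSucc = j.castSucc.succ from rfl, Ring.inverse_mul_cancel _ (hg _), one_mul]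
  · rw [if_neg (by omega), if_neg (by omega),
      Fin.succAbove_of_le_castSucc _ _ (by rw [Fin.le_def]; simp; omega),
      Fin.succAbove_of_le_castSucc _ _ (by rw [Fin.le_def]; simp; omega)]
    rfl

theorem removeNth_mem_NGbar {g : Fin (q + 2) → Mat n} (hg : g ∈ NGbar n (q + 1))
    (i : Fin (q + 2)) : i.removeNth g ∈ NGbar n q := fun _ => hg _

theorem isOpen_NGbar (n q : ℕ) : IsOpen (NGbar n q) := by
  have : NGbar n q = ⋂ j, (fun g : Fin (q + 1) → Mat n => g j) ⁻¹' {a | IsUnit a} := by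
    ext g; simp [NGbar]
  rw [this]
  exact isOpen_iInter_of_finite fun j => Units.isOpen.preimage (continuous_apply j)

theorem differentiable_face_generic {A : Type*} [NormedRing A] [NormedAlgebra ℝ A]
    (i : Fin (q + 2)) : Differentiable ℝ fun (h : Fin (q + 1) → A) (j : Fin q) =>
      if (j : ℕ) + 1 < i then h j.castSucc
      else if (j : ℕ) + 1 = i then h j.castSucc * h j.succ
      else h j.succ := by
  rw [differentiable_pi]
  intro j
  split_ifs <;> fun_prop

theorem differentiable_face (i : Fin (q + 2)) :
    Differentiable ℝ (face i : (Fin (q + 1) → Mat n) → Fin q → Mat n) :=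
  differentiable_face_generic i

theorem fderiv_face_fderiv_gamma {g : Fin (q + 2) → Mat n} (hg : g ∈ NGbar n (q + 1))
    (i : Fin (q + 2)) (ξ : Fin (q + 2) → Mat n) :
    fderiv ℝ (face i) (gamma g) (fderiv ℝ gamma g ξ) =
      fderiv ℝ gamma (i.removeNth g) (i.removeNth ξ) := by
  let R : (Fin (q + 2) → Mat n) →L[ℝ] Fin (q + 1) → Mat n :=
    ContinuousLinearMap.pi fun k => ContinuousLinearMap.proj (i.succAbove k)
  have h1 : HasFDerivAt (fun g => face i (gamma g))
      ((fderiv ℝ (face i) (gamma g)).comp (fderiv ℝ gamma g)) g :=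
    ((differentiable_face i) (gamma g)).hasFDerivAt.comp g (differentiableAt_gamma hg).hasFDerivAt
  have hR : HasFDerivAt R R g := R.hasFDerivAt
  have h2 : HasFDerivAt (fun g => gamma (R g)) ((fderiv ℝ gamma (R g)).comp R) g :=
    (differentiableAt_gamma (removeNth_mem_NGbar hg i)).hasFDerivAt.comp g hR
  -- The identity to be differentiated needs invertible entries, so it holds only near g; openness
  -- of the units suffices.
  have h3 : (fun g : Fin (q + 2) → Mat n => face i (gamma g)) =ᶠ[nhds g] fun g => gamma (R g) := by
    filter_upwards [(isOpen_NGbar n (q + 1)).mem_nhds hg] with g' hg'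
    exact face_gamma hg' i
  exact DFunLike.congr_fun (h1.unique (h2.congr_of_eventuallyEq h3)) ξ

theorem bary_tail {x : Fin (q + 1) → ℝ} (hx : ∑ i, x i = 1) : bary (Fin.tail x) = x := by
  rw [Fin.sum_univ_succ] at hx
  rw [bary, ← Fin.cons_self_tail x]
  simp only [Fin.tail_cons]
  congr 1
  simp only [Fin.tail]
  linarith

theorem baryDir_tail {x : Fin (q + 1) → ℝ} (hx : ∑ i, x i = 0) : baryDir (Fin.tail x) = x := by
  rw [Fin.sum_univ_succ] at hx
  rw [baryDir, ← Fin.cons_self_tail x]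
  simp only [Fin.tail_cons]
  congr 1
  simp only [Fin.tail]
  linarith

theorem bary_simplexFace (i : Fin (q + 2)) (t : Fin q → ℝ) :
    bary (simplexFace i t) = Fin.insertNth (α := fun _ => ℝ) i 0 (bary t) :=
  bary_tail (by rw [Fin.sum_univ_succAbove _ i]; simp [sum_bary])

theorem exists_hasFDerivAt_simplexFace (i : Fin (q + 2)) (t : Fin q → ℝ) :
    ∃ L : (Fin q → ℝ) →L[ℝ] Fin (q + 1) → ℝ, HasFDerivAt (simplexFace i) L t ∧
      ∀ τ, baryDir (L τ) = Fin.insertNth (α := fun _ => ℝ) i 0 (baryDir τ) := by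
  have h : ∀ j : Fin (q + 2), ∃ L : (Fin q → ℝ) →L[ℝ] ℝ,
      (∀ τ, L τ = Fin.insertNth (α := fun _ => ℝ) i 0 (baryDir τ) j) ∧
      HasFDerivAt (fun t => Fin.insertNth (α := fun _ => ℝ) i 0 (bary t) j) L t := by
    intro j
    rcases eq_or_ne j i with rfl | hj
    · exact ⟨0, fun τ => by simp, by simpa using hasFDerivAt_const (0 : ℝ) t⟩
    · obtain ⟨k, rfl⟩ := Fin.exists_succAbove_eq hj
      obtain ⟨L, hL, hL'⟩ := hasFDerivAt_bary t k
      exact ⟨L, fun τ => by simp [hL], by simpa using hL'⟩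
  choose L hL hL' using h
  refine ⟨ContinuousLinearMap.pi fun j => L j.succ, hasFDerivAt_pi.mpr fun j => hL' j.succ,
    fun τ => ?_⟩
  rw [← baryDir_tail (x := Fin.insertNth (α := fun _ => ℝ) i 0 (baryDir τ))
    (by rw [Fin.sum_univ_succAbove _ i]; simp [sum_baryDir])]
  congr 1
  funext j
  exact hL _ _

theorem fderiv_prodMap_apply {T T' E E' : Type*} [NormedAddCommGroup T] [NormedSpace ℝ T]
    [NormedAddCommGroup T'] [NormedSpace ℝ T'] [NormedAddCommGroup E] [NormedSpace ℝ E]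
    [NormedAddCommGroup E'] [NormedSpace ℝ E'] {a : T → T'} {f : E → E'} {t : T} {x : E}
    (ha : DifferentiableAt ℝ a t) (hf : DifferentiableAt ℝ f x) (v : T × E) :
    fderiv ℝ (fun y : T × E => (a y.1, f y.2)) (t, x) v = (fderiv ℝ a t v.1, fderiv ℝ f x v.2) := by
  have h : HasFDerivAt (fun y : T × E => (a y.1, f y.2)) _ (t, x) :=
    HasFDerivAt.prodMap (p := (t, x)) ha.hasFDerivAt hf.hasFDerivAt
  rw [h.fderiv]
  rfl

end Geometry

/-! ### The Chern character form and its invariance -/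

section ChernForm

variable {n q : ℕ}

/-- The trace of the antisymmetrized `p`-th power of a bilinear expression `b`. -/
def antisymmTrace {E : Type*} (p : ℕ) (b : E → E → Mat n) (v : Fin (2 * p) → E) : ℂ :=
  ∑ σ : Equiv.Perm (Fin (2 * p)), Equiv.Perm.sign σ •
    trace n (List.ofFn fun i : Fin p => b (v (σ (evenPos i))) (v (σ (oddPos i)))).prod

theorem antisymmTrace_conj {E E' : Type*} (p : ℕ) {b : E → E → Mat n} {b' : E' → E' → Mat n}
    (L : E → E') {c d : Mat n} (hdc : d * c = 1) (hcd : c * d = 1)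
    (h : ∀ x y, b' (L x) (L y) = c * b x y * d) (v : Fin (2 * p) → E) :
    antisymmTrace p b' (fun i => L (v i)) = antisymmTrace p b v := by
  simp only [antisymmTrace, h, ofFn_prod_conj _ hdc hcd, trace_conj _ hdc]

theorem ofFn_prod_smul {p : ℕ} (κ : ℂ) (f : Fin p → Mat n) :
    (List.ofFn fun i => κ • f i).prod = κ ^ p • (List.ofFn f).prod := by
  induction p with
  | zero => simp
  | succ p ih =>
    rw [ofFn_prod_succ_last, ih, ofFn_prod_succ_last f, smul_mul_smul_comm, pow_succ]

theorem trace_smul (κ : ℂ) (a : Mat n) : trace n (κ • a) = κ * trace n a :=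
  (Matrix.trace_smul (R := ℂ) κ a :)

theorem traceForm_wedgePow_smul_apply {E : Type*} [NormedAddCommGroup E] [NormedSpace ℝ E]
    {Ω : E → E [⋀^Fin 2]→L[ℝ] Mat n} {x : E} {b : E → E → Mat n}
    (hb : ∀ v, Ω x v = b (v 0) (v 1) - b (v 1) (v 0)) (κ : ℂ) (p : ℕ) (v : Fin (2 * p) → E) :
    traceForm (wedgePow (fun y => κ • Ω y) p) x v = κ ^ p * antisymmTrace p b v := by
  have hb' : ∀ v, (fun y => κ • Ω y) x v =
      (fun u w => κ • b u w) (v 0) (v 1) - (fun u w => κ • b u w) (v 1) (v 0) := by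
    intro v
    simp [hb, smul_sub]
  change trace n (wedgePow (fun y => κ • Ω y) p x v) = _
  rw [wedgePow_apply (Ω := fun y => κ • Ω y) (b := fun u w => κ • b u w) hb', map_sum, antisymmTrace, Finset.mul_sum]
  refine Finset.sum_congr rfl fun σ _ => ?_
  rw [trace_units_smul, ofFn_prod_smul, trace_smul, mul_smul_comm]

theorem chernCharacterForm_apply (p : ℕ) (t : Fin q → ℝ) {g : Fin (q + 1) → Mat n}
    (hg : g ∈ NGbar n q) (v : Fin (2 * p) → (Fin q → ℝ) × (Fin (q + 1) → Mat n)) :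
    chernCharacterForm n p q (t, g) v = 1 / (p.factorial : ℂ) *
      ((-(1 / (2 * Real.pi * Complex.I))) ^ p * antisymmTrace p
        (fun u w => curvCoeff t u.1 (logDeriv g u.2) (logDeriv g w.2)) v) := by
  rw [← traceForm_wedgePow_smul_apply (Ω := curvature n q) (x := (t, g)) (curvature_apply t hg)]
  rfl

/-- Gauge invariance: the first sum ignores a shift because the weights dt_i add up to 0, and the
other two terms are minus a covariance with weights t_i of total mass 1, which is translation
invariant. -/
theorem curvCoeff_conj_shift (t τ : Fin q → ℝ) (a a' : Fin (q + 1) → Mat n) (z z' : Mat n)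
    {c d : Mat n} (hdc : d * c = 1) :
    curvCoeff t τ (fun i => c * (a i - z) * d) (fun i => c * (a' i - z') * d) =
      c * curvCoeff t τ a a' * d := by
  have hsum : ∀ (β : Fin (q + 1) → ℝ) (f : Fin (q + 1) → Mat n),
      ∑ i, β i • (c * f i * d) = c * (∑ i, β i • f i) * d := by
    intro β f
    rw [Finset.mul_sum, Finset.sum_mul]
    exact Finset.sum_congr rfl fun i _ => by rw [mul_smul_comm, smul_mul_assoc]
  have hshift : ∀ (β : Fin (q + 1) → ℝ) (f : Fin (q + 1) → Mat n) (z : Mat n),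
      ∑ i, β i • (f i - z) = ∑ i, β i • f i - (∑ i, β i) • z := by
    intro β f z
    simp only [smul_sub, Finset.sum_sub_distrib, Finset.sum_smul]
  have hmul : ∀ x y : Mat n, c * x * d * (c * y * d) = c * (x * y) * d := by
    intro x y
    simp only [mul_assoc]
    rw [← mul_assoc d c, hdc, one_mul]
  have hq : ∑ i, bary t i • ((a i - z) * (a' i - z')) =
      ∑ i, bary t i • (a i * a' i) - (∑ i, bary t i • a i) * z' - z * (∑ i, bary t i • a' i) +
        z * z' := by
    have : ∀ i, bary t i • ((a i - z) * (a' i - z')) = bary t i • (a i * a' i) -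
        (bary t i • a i) * z' - z * (bary t i • a' i) + bary t i • (z * z') := by
      intro i
      simp only [mul_sub, sub_mul, smul_sub, smul_mul_assoc, mul_smul_comm]
      abel
    simp only [this, Finset.sum_add_distrib, Finset.sum_sub_distrib, ← Finset.sum_mul,
      ← Finset.mul_sum, ← Finset.sum_smul, sum_bary, one_smul]
  simp only [curvCoeff, hmul, hsum, hq, hshift, sum_bary, sum_baryDir, one_smul, zero_smul]
  simp only [← mul_sub, ← sub_mul, ← mul_add, ← add_mul]
  congr 2
  simp only [mul_sub, sub_mul]
  abel

/-- On the i-th face both t_i and dt_i vanish, so the i-th form no longer enters. -/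
theorem curvCoeff_removeNth {t τ : Fin (q + 1) → ℝ} {t' τ' : Fin q → ℝ} (i : Fin (q + 2))
    (ht : bary t = Fin.insertNth (α := fun _ => ℝ) i 0 (bary t'))
    (hτ : baryDir τ = Fin.insertNth (α := fun _ => ℝ) i 0 (baryDir τ'))
    (a a' : Fin (q + 2) → Mat n) :
    curvCoeff t τ a a' = curvCoeff t' τ' (i.removeNth a) (i.removeNth a') := by
  simp [curvCoeff, ht, hτ, Fin.sum_univ_succAbove _ i, Fin.removeNth]

/-- The Chern character form on `Δ^{q+1} × N\bar G(q+1)` restricts along the `i`-th face of the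
simplex to the pullback of the one on `Δ^q × N\bar G(q)`. -/
theorem chernCharacterForm_simplexFace (p : ℕ) (i : Fin (q + 2)) (t : Fin q → ℝ)
    {g : Fin (q + 2) → Mat n} (hg : g ∈ NGbar n (q + 1))
    (v : Fin (2 * p) → (Fin q → ℝ) × (Fin (q + 2) → Mat n)) :
    chernCharacterForm n p (q + 1) (simplexFace i t, g)
        (fun k => (fderiv ℝ (simplexFace i) t (v k).1, (v k).2)) =
      chernCharacterForm n p q (t, i.removeNth g) (fun k => ((v k).1, i.removeNth (v k).2)) := by
  obtain ⟨L, hL, hL'⟩ := exists_hasFDerivAt_simplexFace i t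
  rw [chernCharacterForm_apply p _ hg, chernCharacterForm_apply p _ (removeNth_mem_NGbar hg i)]
  rw [hL.fderiv]
  congr 2
  simp only [antisymmTrace, curvCoeff_removeNth i (bary_simplexFace i t) (hL' _)]
  rfl

/-- The forms on `Δ^q × NG(q)` whose pullbacks are the differences of the forms `θ_i`, up to
conjugation, evaluated on a tangent vector. -/
def partialSum (h η : Fin q → Mat n) (i : Fin (q + 1)) : Mat n :=
  -∑ s : Fin q, if (s : ℕ) < i then phi s h (fun _ => η) else 0

/-- The pullbacks of the φ_s are conjugated differences of consecutive θ's, so their sum telescopes.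
-/
theorem partialSum_gamma {g : Fin (q + 1) → Mat n} (hg : g ∈ NGbar n q)
    (ξ : Fin (q + 1) → Mat n) (i : Fin (q + 1)) :
    partialSum (gamma g) (fderiv ℝ gamma g ξ) i =
      g 0 * (logDeriv g ξ i - logDeriv g ξ 0) * Ring.inverse (g 0) := by
  simp only [partialSum, phi_gamma_fderiv_gamma hg]
  induction i using Fin.induction with
  | zero => simp
  | succ i ih =>
    have : ∀ f : Fin q → Mat n, (∑ s : Fin q, if (s : ℕ) < i.succ then f s else 0) =
        (∑ s : Fin q, if (s : ℕ) < i.castSucc then f s else 0) + f i := by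
      intro f
      have hi : f i = ∑ s, if s = i then f s else 0 := by simp
      rw [hi, ← Finset.sum_add_distrib]
      refine Finset.sum_congr rfl fun s _ => ?_
      simp only [Fin.val_succ, Fin.val_castSucc, Fin.ext_iff]
      split_ifs <;> first | omega | simp
    rw [this, neg_add, ih, ← sub_eq_add_neg, ← sub_mul, ← mul_sub]
    congr 2
    abel

/-- The descent: the pulled-back data are the θ_i shifted by θ_0 and conjugated by g_0, which the
trace of the power does not see. -/
theorem antisymmTrace_gamma (p : ℕ) (t : Fin q → ℝ) {g : Fin (q + 1) → Mat n}
    (hg : g ∈ NGbar n q) (v : Fin (2 * p) → (Fin q → ℝ) × (Fin (q + 1) → Mat n)) :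
    antisymmTrace p (fun u w : (Fin q → ℝ) × (Fin q → Mat n) =>
        curvCoeff t u.1 (partialSum (gamma g) u.2) (partialSum (gamma g) w.2))
        (fun i => ((v i).1, fderiv ℝ gamma g (v i).2)) =
      antisymmTrace p (fun u w => curvCoeff t u.1 (logDeriv g u.2) (logDeriv g w.2)) v := by
  refine antisymmTrace_conj p (fun u : (Fin q → ℝ) × (Fin (q + 1) → Mat n) =>
    (u.1, fderiv ℝ gamma g u.2)) (Ring.inverse_mul_cancel _ (hg 0))
    (Ring.mul_inverse_cancel _ (hg 0)) (fun u w => ?_) v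
  simp only [funext (partialSum_gamma hg _)]
  exact curvCoeff_conj_shift t u.1 _ _ _ _ (Ring.inverse_mul_cancel _ (hg 0))

end ChernForm

/-! ### Existence of the simplicial Chern character form -/

section Existence

variable {n q : ℕ}

/-- A form on a finite-dimensional space is smooth if its values on constant vectors are. -/
theorem contDiffOn_of_apply {E F : Type*} [NormedAddCommGroup E] [NormedSpace ℝ E]
    [FiniteDimensional ℝ E] [NormedAddCommGroup F] [NormedSpace ℝ F] [FiniteDimensional ℝ F]
    {k : ℕ} {α : E → E [⋀^Fin k]→L[ℝ] F} {S : Set E}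
    (h : ∀ v, ContDiffOn ℝ ∞ (fun x => α x v) S) : ContDiffOn ℝ ∞ α S := by
  let e := Module.finBasis ℝ E
  -- A form is determined by its values on basis vectors, so this linear map is injective; a left
  -- inverse, continuous by finite dimension, recovers α from scalar-parameter functions known to be
  -- smooth.
  let ev : E [⋀^Fin k]→L[ℝ] F →ₗ[ℝ] (Fin k → Fin (Module.finrank ℝ E)) → F :=
    { toFun := fun f w => f fun i => e (w i)
      map_add' := fun _ _ => rfl
      map_smul' := fun _ _ => rfl }
  have hev : LinearMap.ker ev = ⊥ := by
    rw [LinearMap.ker_eq_bot]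
    intro f g hfg
    apply ContinuousAlternatingMap.toAlternatingMap_injective
    refine Module.Basis.ext_alternating e fun w _ => ?_
    exact congrFun hfg w
  obtain ⟨r, hr⟩ := ev.exists_leftInverse_of_injective hev
  have hα : α = fun x => r.toContinuousLinearMap (ev (α x)) := by
    funext x
    exact (LinearMap.congr_fun hr (α x)).symm
  rw [hα]
  refine r.toContinuousLinearMap.contDiff.comp_contDiffOn ?_
  exact contDiffOn_pi.mpr fun w => h _

/-! ### Smoothness of the φ_s and of wedge products -/

theorem contDiff_take_prod {A : Type*} [NormedRing A] [NormedAlgebra ℝ A] (k : ℕ) :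
    ContDiff ℝ ∞ fun h : Fin q → A => ((List.ofFn h).take k).prod := by
  induction k with
  | zero => simpa using contDiff_const
  | succ k ih =>
    by_cases hk : k < q
    · have : (fun h : Fin q → A => ((List.ofFn h).take (k + 1)).prod) =
          fun h => ((List.ofFn h).take k).prod * h ⟨k, hk⟩ := by
        funext h
        rw [List.prod_take_succ _ _ (by simpa using hk), List.getElem_ofFn]
      rw [this]
      exact ih.mul (contDiff_apply ℝ A _)
    · have : (fun h : Fin q → A => ((List.ofFn h).take (k + 1)).prod) =
          fun h => ((List.ofFn h).take k).prod := by
        funext h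
        rw [List.take_of_length_le (by simp; omega), List.take_of_length_le (by simp; omega)]
      rw [this]
      exact ih

theorem isUnit_take_prod {A : Type*} [Monoid A] {h : Fin q → A} (hh : ∀ i, IsUnit (h i)) (k : ℕ) :
    IsUnit ((List.ofFn h).take k).prod := by
  refine List.prod_isUnit fun a ha => ?_
  obtain ⟨i, rfl⟩ := List.mem_ofFn.mp (List.mem_of_mem_take ha)
  exact hh i

theorem contDiffOn_mul_inverse_take_prod {A : Type*} [NormedRing A] [NormedAlgebra ℝ A]
    [CompleteSpace A] {T : Type*} [NormedAddCommGroup T] [NormedSpace ℝ T] (k l : ℕ) (a : A)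
    (S : Set T) :
    ContDiffOn ℝ ∞ (fun x : T × (Fin q → A) => ((List.ofFn x.2).take k).prod * a *
      Ring.inverse ((List.ofFn x.2).take l).prod) (S ×ˢ {h | ∀ j, IsUnit (h j)}) := by
  refine ContDiffOn.mul (((contDiff_take_prod k).comp contDiff_snd).mul contDiff_const).contDiffOn ?_
  rintro x ⟨-, hx⟩
  obtain ⟨u, hu⟩ := isUnit_take_prod hx l
  have h1 : ContDiffAt ℝ ∞ Ring.inverse ((List.ofFn x.2).take l).prod := by
    rw [← hu]; exact contDiffAt_ringInverse ℝ u
  exact (h1.comp x ((contDiff_take_prod l).comp contDiff_snd).contDiffAt).contDiffWithinAt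

theorem contDiffOn_wedge_apply {E F F' F'' : Type*} [NormedAddCommGroup E] [NormedSpace ℝ E]
    [NormedAddCommGroup F] [NormedSpace ℝ F] [NormedAddCommGroup F'] [NormedSpace ℝ F']
    [NormedAddCommGroup F''] [NormedSpace ℝ F''] {k l : ℕ} {B : F →L[ℝ] F' →L[ℝ] F''}
    {α : E → E [⋀^Fin k]→L[ℝ] F} {β : E → E [⋀^Fin l]→L[ℝ] F'} {S : Set E}
    (hα : ∀ v, ContDiffOn ℝ ∞ (fun x => α x v) S) (hβ : ∀ v, ContDiffOn ℝ ∞ (fun x => β x v) S)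
    (v : Fin (k + l) → E) : ContDiffOn ℝ ∞ (fun x => wedge B α β x v) S := by
  simp only [wedge_apply]
  refine contDiffOn_const.smul (ContDiffOn.sum fun σ _ => ?_)
  have : ContDiffOn ℝ ∞ (fun x => B (α x fun i => v (σ (Fin.castAdd l i)))
      (β x fun j => v (σ (Fin.natAdd k j)))) S :=
    (B.contDiff.comp_contDiffOn (hα _)).clm_apply (hβ _)
  rcases Int.units_eq_one_or (Equiv.Perm.sign σ) with h | h
  · simpa [h] using this
  · simpa [h] using this.neg

theorem contDiffOn_wedgePow_apply {E : Type*} [NormedAddCommGroup E] [NormedSpace ℝ E]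
    {Ω : E → E [⋀^Fin 2]→L[ℝ] Mat n} {S : Set E}
    (hΩ : ∀ v, ContDiffOn ℝ ∞ (fun x => Ω x v) S) (p : ℕ) (v : Fin (2 * p) → E) :
    ContDiffOn ℝ ∞ (fun x => wedgePow Ω p x v) S := by
  induction p with
  | zero => exact contDiffOn_const
  | succ p ih => exact contDiffOn_wedge_apply ih hΩ v

/-! ### The explicit curvature and Chern form on Δ^q × NG(q) -/

/-- The differential of the `i`-th barycentric coordinate. -/
def baryDirCLM (i : Fin (q + 1)) : (Fin q → ℝ) →L[ℝ] ℝ :=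
  fderiv ℝ (fun t => bary t i) 0

theorem baryDirCLM_apply (i : Fin (q + 1)) (τ : Fin q → ℝ) : baryDirCLM i τ = baryDir τ i := by
  obtain ⟨L, hL, hL'⟩ := hasFDerivAt_bary (0 : Fin q → ℝ) i
  rw [baryDirCLM, hL'.fderiv, hL]

theorem contDiff_bary (i : Fin (q + 1)) : ContDiff ℝ ∞ fun t : Fin q → ℝ => bary t i := by
  refine Fin.cases ?_ (fun j => ?_) i
  · exact contDiff_const.sub (ContDiff.sum fun j _ => contDiff_apply ℝ ℝ j)
  · exact contDiff_apply ℝ ℝ j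

/-- The form `dt_i` with values in the scalar matrices. -/
def baryForm (n : ℕ) (i : Fin (q + 1)) : (Fin q → ℝ) × (Fin q → Mat n) →
    ((Fin q → ℝ) × (Fin q → Mat n)) [⋀^Fin 1]→L[ℝ] Mat n :=
  oneForm fun _ => ((baryDirCLM i).comp (ContinuousLinearMap.fst ℝ _ _)).smulRight (1 : Mat n)

theorem baryForm_apply (i : Fin (q + 1)) (x : (Fin q → ℝ) × (Fin q → Mat n))
    (v : Fin 1 → (Fin q → ℝ) × (Fin q → Mat n)) :
    baryForm n i x v = baryDir (v 0).1 i • (1 : Mat n) := by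
  simp [baryForm, oneForm, baryDirCLM_apply]

/-- The form `-(φ_1 + ⋯ + φ_i)`, which corresponds to `θ_i - θ_0`. -/
def partialSumForm (n : ℕ) (i : Fin (q + 1)) : (Fin q → ℝ) × (Fin q → Mat n) →
    ((Fin q → ℝ) × (Fin q → Mat n)) [⋀^Fin 1]→L[ℝ] Mat n :=
  fun x => -∑ s : Fin q, if (s : ℕ) < i then
    (phi s x.2).compContinuousLinearMap (ContinuousLinearMap.snd ℝ _ _) else 0

theorem partialSumForm_apply (i : Fin (q + 1)) (x : (Fin q → ℝ) × (Fin q → Mat n))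
    (v : Fin 1 → (Fin q → ℝ) × (Fin q → Mat n)) :
    partialSumForm n i x v = partialSum x.2 (v 0).2 i := by
  rw [partialSumForm, partialSum, ContinuousAlternatingMap.neg_apply,
    ContinuousAlternatingMap.sum_apply]
  congr 1
  refine Finset.sum_congr rfl fun s _ => ?_
  split_ifs
  · rw [ContinuousAlternatingMap.compContinuousLinearMap_apply, phi_apply, phi_apply]
    rfl
  · rfl

theorem contDiffOn_partialSumForm_apply (i : Fin (q + 1))
    (v : Fin 1 → (Fin q → ℝ) × (Fin q → Mat n)) (S : Set (Fin q → ℝ)) :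
    ContDiffOn ℝ ∞ (fun x => partialSumForm n i x v) (S ×ˢ NG n q) := by
  simp only [partialSumForm_apply, partialSum, phi_apply]
  refine (ContDiffOn.sum fun s _ => ?_).neg
  split_ifs
  · exact contDiffOn_mul_inverse_take_prod _ _ _ _
  · exact contDiffOn_const

/-- The connection on `Δ^q × NG(q)` in the trivialization with `g_0 = 1`. -/
def trivConnection (n q : ℕ) : (Fin q → ℝ) × (Fin q → Mat n) →
    ((Fin q → ℝ) × (Fin q → Mat n)) [⋀^Fin 1]→L[ℝ] Mat n :=
  fun x => ∑ i : Fin (q + 1), bary x.1 i • partialSumForm n i x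

/-- The curvature on `Δ^q × NG(q)` in the trivialization with `g_0 = 1`. -/
def trivCurvature (n q : ℕ) : (Fin q → ℝ) × (Fin q → Mat n) →
    ((Fin q → ℝ) × (Fin q → Mat n)) [⋀^Fin 2]→L[ℝ] Mat n :=
  fun x => ∑ i : Fin (q + 1), wedgeMul (baryForm n i) (partialSumForm n i) x -
    ∑ i : Fin (q + 1), bary x.1 i • wedgeMul (partialSumForm n i) (partialSumForm n i) x +
    wedgeMul (trivConnection n q) (trivConnection n q) x

theorem trivConnection_apply (x : (Fin q → ℝ) × (Fin q → Mat n))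
    (v : Fin 1 → (Fin q → ℝ) × (Fin q → Mat n)) :
    trivConnection n q x v = ∑ i : Fin (q + 1), bary x.1 i • partialSum x.2 (v 0).2 i := by
  simp [trivConnection, partialSumForm_apply]

/-- `trivCurvature` is written out as wedge products, so no exterior derivative on NG is needed to
match it with `curvCoeff`. -/
theorem trivCurvature_apply (t : Fin q → ℝ) (h : Fin q → Mat n)
    (v : Fin 2 → (Fin q → ℝ) × (Fin q → Mat n)) :
    trivCurvature n q (t, h) v =
      curvCoeff t (v 0).1 (partialSum h (v 0).2) (partialSum h (v 1).2) -
        curvCoeff t (v 1).1 (partialSum h (v 1).2) (partialSum h (v 0).2) := by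
  simp only [trivCurvature, ContinuousAlternatingMap.add_apply, ContinuousAlternatingMap.sub_apply,
    ContinuousAlternatingMap.sum_apply, ContinuousAlternatingMap.smul_apply, wedgeMul,
    wedge_one_one_apply, ContinuousLinearMap.mul_apply', trivConnection_apply,
    partialSumForm_apply, baryForm_apply, curvCoeff, smul_mul_assoc, one_mul, smul_sub,
    Finset.sum_sub_distrib]
  abel

theorem contDiffOn_trivCurvature_apply (v : Fin 2 → (Fin q → ℝ) × (Fin q → Mat n))
    (S : Set (Fin q → ℝ)) :
    ContDiffOn ℝ ∞ (fun x => trivCurvature n q x v) (S ×ˢ NG n q) := by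
  have hb : ∀ i, ContDiffOn ℝ ∞ (fun x : (Fin q → ℝ) × (Fin q → Mat n) => bary x.1 i)
    (S ×ˢ NG n q) := fun i => ((contDiff_bary i).comp contDiff_fst).contDiffOn
  have hA := fun i v => contDiffOn_partialSumForm_apply (n := n) (q := q) i v S
  simp only [trivCurvature, ContinuousAlternatingMap.add_apply, ContinuousAlternatingMap.sub_apply,
    ContinuousAlternatingMap.sum_apply, ContinuousAlternatingMap.smul_apply]
  refine ((ContDiffOn.sum fun i _ => ?_).sub (ContDiffOn.sum fun i _ => ?_)).add ?_
  · refine contDiffOn_wedge_apply (fun v => ?_) (hA i) v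
    simp only [baryForm_apply]
    exact contDiffOn_const
  · exact (hb i).smul (contDiffOn_wedge_apply (hA i) (hA i) v)
  · have hθ : ∀ v, ContDiffOn ℝ ∞ (fun x => trivConnection n q x v) (S ×ˢ NG n q) := by
      intro v
      simp only [trivConnection, ContinuousAlternatingMap.sum_apply,
        ContinuousAlternatingMap.smul_apply]
      exact ContDiffOn.sum fun i _ => (hb i).smul (hA i v)
    exact contDiffOn_wedge_apply hθ hθ v

/-- The Chern character form on `Δ^q × NG(q)`. -/
def trivChernForm (n p q : ℕ) : (Fin q → ℝ) × (Fin q → Mat n) →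
    ((Fin q → ℝ) × (Fin q → Mat n)) [⋀^Fin (2 * p)]→L[ℝ] ℂ :=
  fun x => (1 / (p.factorial : ℂ)) •
    traceForm (wedgePow (fun y => (-(1 / (2 * Real.pi * Complex.I)) : ℂ) • trivCurvature n q y) p) x

theorem trivChernForm_apply (p : ℕ) (t : Fin q → ℝ) (h : Fin q → Mat n)
    (v : Fin (2 * p) → (Fin q → ℝ) × (Fin q → Mat n)) :
    trivChernForm n p q (t, h) v = 1 / (p.factorial : ℂ) *
      ((-(1 / (2 * Real.pi * Complex.I))) ^ p * antisymmTrace p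
        (fun u w => curvCoeff t u.1 (partialSum h u.2) (partialSum h w.2)) v) := by
  rw [← traceForm_wedgePow_smul_apply (Ω := trivCurvature n q) (x := (t, h))
    (trivCurvature_apply t h)]
  rfl

theorem contDiffOn_trivChernForm (p : ℕ) (S : Set (Fin q → ℝ)) :
    ContDiffOn ℝ ∞ (trivChernForm n p q) (S ×ˢ NG n q) := by
  refine contDiffOn_of_apply fun v => ?_
  have h := contDiffOn_wedgePow_apply
    (Ω := fun y => (-(1 / (2 * Real.pi * Complex.I)) : ℂ) • trivCurvature n q y)
    (fun w => (contDiffOn_trivCurvature_apply w S).const_smul _) p v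
  exact ((trace n).contDiff.comp_contDiffOn h).const_smul (1 / (p.factorial : ℂ))

/-! ### Descent along id × γ and face compatibility -/

theorem fderiv_id_gamma_apply (t : Fin q → ℝ) {g : Fin (q + 1) → Mat n} (hg : g ∈ NGbar n q)
    (v : (Fin q → ℝ) × (Fin (q + 1) → Mat n)) :
    fderiv ℝ (fun y : (Fin q → ℝ) × (Fin (q + 1) → Mat n) => (y.1, gamma y.2)) (t, g) v =
      (v.1, fderiv ℝ gamma g v.2) := by
  rw [fderiv_prodMap_apply (a := fun t => t) differentiableAt_id (differentiableAt_gamma hg)]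
  simp

/-- The Chern-Weil identity at a point, in terms of values on tangent vectors. -/
theorem pullback_id_gamma_apply {m : ℕ} (α : (Fin q → ℝ) × (Fin q → Mat n) →
      ((Fin q → ℝ) × (Fin q → Mat n)) [⋀^Fin m]→L[ℝ] ℂ)
    (t : Fin q → ℝ) {g : Fin (q + 1) → Mat n} (hg : g ∈ NGbar n q)
    (v : Fin m → (Fin q → ℝ) × (Fin (q + 1) → Mat n)) :
    pullback (fun y : (Fin q → ℝ) × (Fin (q + 1) → Mat n) => (y.1, gamma y.2)) α (t, g) v =
      α (t, gamma g) fun i => ((v i).1, fderiv ℝ gamma g (v i).2) := by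
  rw [pullback, ContinuousAlternatingMap.compContinuousLinearMap_apply]
  congr 1
  funext i
  exact fderiv_id_gamma_apply t hg (v i)

theorem trivChernForm_gamma (p : ℕ) (t : Fin q → ℝ) {g : Fin (q + 1) → Mat n}
    (hg : g ∈ NGbar n q) (v : Fin (2 * p) → (Fin q → ℝ) × (Fin (q + 1) → Mat n)) :
    trivChernForm n p q (t, gamma g) (fun i => ((v i).1, fderiv ℝ gamma g (v i).2)) =
      chernCharacterForm n p q (t, g) v := by
  rw [chernCharacterForm_apply p t hg, trivChernForm_apply, antisymmTrace_gamma p t hg]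

/-- Point and tangent vectors are lifted through γ, where both sides become values of the Chern
character form on N\bar G and the face identity there applies. -/
theorem trivChernForm_compatible (p : ℕ) (i : Fin (q + 2)) {t : Fin q → ℝ}
    {h : Fin (q + 1) → Mat n} (hh : h ∈ NG n (q + 1)) :
    pullback (fun y : (Fin q → ℝ) × (Fin (q + 1) → Mat n) => (simplexFace i y.1, y.2))
        (trivChernForm n p (q + 1)) (t, h) =
      pullback (fun y : (Fin q → ℝ) × (Fin (q + 1) → Mat n) => (y.1, face i y.2))
        (trivChernForm n p q) (t, h) := by
  obtain ⟨g, hg, rfl⟩ := exists_gamma_eq hh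
  obtain ⟨L, hL, -⟩ := exists_hasFDerivAt_simplexFace i t
  ext v
  choose ξ hξ using fun k => fderiv_gamma_surjective hg (v k).2
  have h1 : ∀ k, fderiv ℝ (fun y : (Fin q → ℝ) × (Fin (q + 1) → Mat n) => (simplexFace i y.1, y.2))
      (t, gamma g) (v k) = (fderiv ℝ (simplexFace i) t (v k).1, fderiv ℝ gamma g (ξ k)) := by
    intro k
    rw [hξ, fderiv_prodMap_apply (f := fun h => h) hL.differentiableAt differentiableAt_id]
    simp
  have h2 : ∀ k, fderiv ℝ (fun y : (Fin q → ℝ) × (Fin (q + 1) → Mat n) => (y.1, face i y.2))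
      (t, gamma g) (v k) = ((v k).1, fderiv ℝ gamma (i.removeNth g) (i.removeNth (ξ k))) := by
    intro k
    rw [← fderiv_face_fderiv_gamma hg, hξ,
      fderiv_prodMap_apply (a := fun t => t) differentiableAt_id (differentiable_face i _)]
    simp
  rw [pullback, pullback, ContinuousAlternatingMap.compContinuousLinearMap_apply,
    ContinuousAlternatingMap.compContinuousLinearMap_apply]
  simp only [Function.comp_def, h1, h2, face_gamma hg]
  rw [trivChernForm_gamma p (simplexFace i t) hg
      (fun k => (fderiv ℝ (simplexFace i) t (v k).1, ξ k)),
    trivChernForm_gamma p t (removeNth_mem_NGbar hg i)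
      (fun k => ((v k).1, i.removeNth (ξ k)))]
  exact chernCharacterForm_simplexFace p i t hg fun k => ((v k).1, ξ k)

/-- The simplicial Chern character form on `NG`. -/
def chernSimplicialForm (n p : ℕ) : SimplicialForm n (2 * p) where
  form q := trivChernForm n p q
  smooth q := contDiffOn_trivChernForm p (simplex q)
  compatible _ i := fun _ hx => trivChernForm_compatible p i hx.2

theorem isChernWeilForm_chernSimplicialForm (n p : ℕ) :
    IsChernWeilForm p (chernSimplicialForm n p) := by
  rintro q ⟨t, g⟩ ⟨-, hg⟩
  ext v
  rw [pullback_id_gamma_apply _ t hg]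
  exact trivChernForm_gamma p t hg v

end Existence

/-! ### The component of degree `p` on `NG(p)` -/

section Component

variable {n q : ℕ}

theorem castDegree_apply {E F : Type*} [NormedAddCommGroup E] [NormedSpace ℝ E]
    [NormedAddCommGroup F] [NormedSpace ℝ F] {k l : ℕ} (h : k = l) (α : E → E [⋀^Fin k]→L[ℝ] F)
    (x : E) (v : Fin l → E) : castDegree h α x v = α x fun i => v (Fin.cast h i) := by
  subst h
  rfl

/-- Pullback along a surjective submersion is injective on forms: every point and every tuple of
tangent vectors lifts. -/
theorem IsChernWeilForm.form_eq {p : ℕ} {Φ : SimplicialForm n (2 * p)} (hΦ : IsChernWeilForm p Φ)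
    {t : Fin q → ℝ} {h : Fin q → Mat n} (ht : t ∈ simplex q) (hh : h ∈ NG n q) :
    Φ.form q (t, h) = trivChernForm n p q (t, h) := by
  obtain ⟨g, hg, rfl⟩ := exists_gamma_eq hh
  ext v
  choose ξ hξ using fun k => fderiv_gamma_surjective hg (v k).2
  have h1 := DFunLike.congr_fun (hΦ q (Set.mk_mem_prod ht hg)) fun k => ((v k).1, ξ k)
  rw [pullback_id_gamma_apply _ t hg, ← trivChernForm_gamma p t hg] at h1
  simpa only [hξ] using h1

theorem partialSum_zero_right (h : Fin q → Mat n) : partialSum h 0 = 0 := by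
  funext i
  simp [partialSum, phi_apply]

theorem curvCoeff_zero_right (t τ : Fin q → ℝ) (a : Fin (q + 1) → Mat n) :
    curvCoeff t τ a 0 = 0 := by
  simp [curvCoeff]

/-- The i-th coordinate vector has dt_0 = -1 and one further nonzero barycentric component; since
the partial sum at index 0 is zero, only the one at i + 1 remains. The products vanish because the
NG component of the first vector is 0. -/
theorem curvCoeff_single_zero (t : Fin q → ℝ) (i : Fin q) (h η : Fin q → Mat n) :
    curvCoeff t (Pi.single i 1) 0 (partialSum h η) =
      ∑ s, (if s ≤ i then -1 else 0 : ℝ) • phi s h fun _ => η := by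
  have h0 : partialSum h η 0 = 0 := by simp [partialSum]
  simp only [curvCoeff, Fin.sum_univ_succ (n := q), baryDir, Fin.cons_zero, Fin.cons_succ, h0]
  simp [Pi.single_apply, partialSum, ite_smul,
    ← Finset.sum_neg_distrib]
  refine Finset.sum_congr rfl fun s _ => ?_
  split_ifs <;> simp

theorem det_ite_le (p : ℕ) :
    Matrix.det (Matrix.of fun i s : Fin p => if s ≤ i then (-1 : ℝ) else 0) = (-1) ^ p := by
  rw [Matrix.det_of_isLowerTriangular]
  · simp
  · intro i j hij
    have : i < j := hij
    simp [this]

theorem trivChernForm_append (p : ℕ) (t : Fin p → ℝ) (h : Fin p → Mat n)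
    (v : Fin p → Fin p → Mat n) :
    trivChernForm n p p (t, h) (fun k => Fin.append (fun i => (Pi.single i 1, 0))
        (fun i => (0, v i)) (Fin.cast (two_mul p) k)) =
      (-1) ^ (p * (p - 1) / 2) * (1 / (p.factorial : ℂ)) * (1 / (2 * Real.pi * Complex.I)) ^ p *
        ∑ a : Equiv.Perm (Fin p), ∑ c : Equiv.Perm (Fin p),
          (Equiv.Perm.sign a * Equiv.Perm.sign c) •
            trace n (List.ofFn fun i => phi (a i) h fun _ => v (c i)).prod := by
  set e : Fin p → (Fin p → ℝ) × (Fin p → Mat n) := fun i => (Pi.single i 1, 0) with he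
  set w : Fin p → (Fin p → ℝ) × (Fin p → Mat n) := fun i => (0, v i) with hw
  set b : (Fin p → ℝ) × (Fin p → Mat n) → (Fin p → ℝ) × (Fin p → Mat n) → Mat n :=
    fun u w => curvCoeff t u.1 (partialSum h u.2) (partialSum h w.2) with hb
  have hbe : ∀ u i, b u (e i) = 0 := by
    intro u i
    simp only [hb, he, partialSum_zero_right, curvCoeff_zero_right]
  have hbw : ∀ i j, b (e i) (w j) =
      ∑ s, (Matrix.of fun i s : Fin p => if s ≤ i then (-1 : ℝ) else 0) i s •
        phi s h fun _ => v j := by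
    intro i j
    simp only [hb, he, hw, partialSum_zero_right, curvCoeff_single_zero, Matrix.of_apply]
  have hsum : antisymmTrace p b (fun k => Fin.append e w (Fin.cast (two_mul p) k)) =
      ((-1) ^ (p * (p - 1) / 2) : ℤˣ) • ((-1 : ℝ) ^ p •
        ∑ a : Equiv.Perm (Fin p), ∑ c : Equiv.Perm (Fin p),
          (Equiv.Perm.sign a * Equiv.Perm.sign c) •
            trace n (List.ofFn fun i => phi (a i) h fun _ => v (c i)).prod) := by
    have h1 := congrArg (trace n) (sum_sign_smul_pairs b e w hbe)
    simp only [map_sum, trace_units_smul] at h1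
    rw [antisymmTrace, h1]
    congr 1
    -- The determinant lemma is applied for each fixed arrangement c of the NG vectors, so the sum
    -- over c goes outside.
    rw [Finset.sum_comm, Finset.sum_comm (f := fun a c => (Equiv.Perm.sign a *
      Equiv.Perm.sign c) • trace n (List.ofFn fun i => phi (a i) h fun _ => v (c i)).prod),
      Finset.smul_sum]
    refine Finset.sum_congr rfl fun c _ => ?_
    have h2 := congrArg (trace n) (sum_sign_smul_linearCombination
      (Matrix.of fun i s : Fin p => if s ≤ i then (-1 : ℝ) else 0)
      (fun s j => phi s h fun _ => v j) c)
    rw [det_ite_le] at h2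
    simp only [map_sum, trace_units_smul, map_smul, ← hbw] at h2
    simp only [mul_comm (Equiv.Perm.sign _) (Equiv.Perm.sign c), mul_smul, ← Finset.smul_sum, h2]
    rw [smul_comm]
  rw [trivChernForm_apply, hsum]
  have hu : ∀ (k : ℕ) (z : ℂ), ((-1 : ℤˣ) ^ k) • z = (-1) ^ k * z := by
    intro k z
    rcases Nat.even_or_odd k with hk | hk <;> simp [hk.neg_one_pow]
  rw [hu, Complex.real_smul, neg_pow]
  push_cast
  -- One (-1)^p is the determinant, the other comes from -Ω.
  have h1 : ((-1 : ℂ) ^ p) * (-1) ^ p = 1 := by rw [← mul_pow]; simp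
  linear_combination (1 / (p.factorial : ℂ)) * (1 / (2 * Real.pi * Complex.I)) ^ p *
    (-1) ^ (p * (p - 1) / 2) * (∑ a : Equiv.Perm (Fin p), ∑ c : Equiv.Perm (Fin p),
          (Equiv.Perm.sign a * Equiv.Perm.sign c) •
            trace n (List.ofFn fun i => phi (a i) h fun _ => v (c i)).prod) * h1

theorem alternatingSum_apply (m : ℕ) (h : Fin (m + 1) → Mat n) (w : Fin m → Fin (m + 1) → Mat n) :
    alternatingSum n (m + 1) h w = ∑ π : Equiv.Perm (Fin m), Equiv.Perm.sign π •
      ∑ σ : Equiv.Perm (Fin m), Equiv.Perm.sign σ •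
        (List.ofFn fun j : Fin m => phi (σ j).succ h fun _ => w (π j)).prod := by
  simp only [Finset.smul_sum]
  rw [Finset.sum_comm]
  -- Term-mode steps, because the degree m + 1 - 1 in `alternatingSum` is m only up to reduction.
  refine (ContinuousAlternatingMap.sum_apply _ _).trans ?_
  refine Finset.sum_congr rfl fun σ _ => ?_
  refine (congrArg (fun z => (((Equiv.Perm.sign σ : ℤˣ) : ℤ) : ℝ) • z)
    (wedgeProd_apply (k := m) _ h w)).trans ?_
  rw [Finset.smul_sum]
  refine Finset.sum_congr rfl fun π _ => ?_
  rcases Int.units_eq_one_or (Equiv.Perm.sign σ) with hσ | hσ <;> rw [hσ] <;> simp <;> rfl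

theorem traceForm_phi_alternatingSum_apply (m : ℕ) (hm : 1 + m = m + 1) (h : Fin (m + 1) → Mat n)
    (v : Fin (m + 1) → Fin (m + 1) → Mat n) :
    traceForm (castDegree hm (wedgeMul (k := 1) (l := m) (phi 0) (alternatingSum n (m + 1)))) h v =
      ∑ σ : Equiv.Perm (Fin m), ∑ c : Equiv.Perm (Fin (m + 1)),
        (Equiv.Perm.sign σ * Equiv.Perm.sign c) •
          trace n (phi 0 h (fun _ => v (c 0)) *
            (List.ofFn fun j : Fin m => phi (σ j).succ h fun _ => v (c j.succ)).prod) := by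
  change trace n (castDegree hm _ h v) = _
  rw [castDegree_apply, wedgeMul_apply_of_antisymm (k := 1) (l := m)
    (F := fun w => phi 0 h fun _ => w 0)
    (G := fun w => ∑ σ : Equiv.Perm (Fin m), Equiv.Perm.sign σ •
        (List.ofFn fun j : Fin m => phi (σ j).succ h fun _ => w j).prod)
    (fun w => by simp [phi_apply]) (alternatingSum_apply m h), map_sum, Finset.sum_comm]
  rw [← ((finCongr hm).symm.permCongr).sum_comp]
  refine Finset.sum_congr rfl fun c _ => ?_
  rw [Equiv.Perm.sign_permCongr, Finset.mul_sum, trace_units_smul, map_sum, Finset.smul_sum]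
  refine Finset.sum_congr rfl fun σ _ => ?_
  rw [mul_comm (Equiv.Perm.sign σ), mul_smul]
  congr 1
  rw [← trace_units_smul, mul_smul_comm]
  have h0 : ∀ i : Fin 1, Fin.cast hm (Fin.castAdd m i) = 0 := by
    intro i; ext; simp
  have h1 : ∀ j : Fin m, Fin.cast hm (Fin.natAdd 1 j) = j.succ := by
    intro j; ext; simp
  simp only [Equiv.permCongr_apply, finCongr_symm, finCongr_apply, h0, h1,
    Fin.cast_cast, Fin.cast_eq_self]

open MeasureTheory in
theorem integrateSimplex_eq {m : ℕ} {Φ : SimplicialForm n (2 * (m + 1))}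
    (hΦ : IsChernWeilForm (m + 1) Φ) {h : Fin (m + 1) → Mat n} (hh : h ∈ NG n (m + 1))
    (hm : 1 + m = m + 1) :
    integrateSimplex Φ (m + 1) (m + 1) (two_mul (m + 1)) h =
      ((-1 : ℂ) ^ ((m + 1) * m / 2) * (1 / (((m + 1).factorial : ℂ) * (m.factorial : ℂ))) *
          (1 / (2 * Real.pi * Complex.I)) ^ (m + 1)) •
        traceForm (castDegree hm
          (wedgeMul (k := 1) (l := m) (phi 0) (alternatingSum n (m + 1)))) h := by
  -- The integrand is constant in t; the factor m + 1 from cyclicity has turned 1/(m + 1)! into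
  -- 1/m!, and the volume of the simplex supplies 1/(m + 1)! again.
  have hconst : ∀ t ∈ simplex (m + 1),
      (contract (castDegree (two_mul (m + 1)) (Φ.form (m + 1)) (t, h))
          fun i => (Pi.single i 1, 0)).compContinuousLinearMap
        (ContinuousLinearMap.inr ℝ (Fin (m + 1) → ℝ) (Fin (m + 1) → Mat n)) =
      ((-1 : ℂ) ^ ((m + 1) * m / 2) * (1 / (m.factorial : ℂ)) *
          (1 / (2 * Real.pi * Complex.I)) ^ (m + 1)) •
        traceForm (castDegree hm
          (wedgeMul (k := 1) (l := m) (phi 0) (alternatingSum n (m + 1)))) h := by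
    intro t ht
    ext v
    rw [ContinuousAlternatingMap.compContinuousLinearMap_apply]
    change castDegree (two_mul (m + 1)) (Φ.form (m + 1)) (t, h)
      (Fin.append (fun i => (Pi.single i 1, 0)) fun i => (0, v i)) = _
    rw [castDegree_apply, hΦ.form_eq ht hh, trivChernForm_append,
      sum_sign_trace_eq (fun s j => phi s h fun _ => v j), ContinuousAlternatingMap.smul_apply,
      traceForm_phi_alternatingSum_apply, Nat.add_sub_cancel, Nat.factorial_succ, nsmul_eq_mul,
      smul_eq_mul]
    have h1 : (m.factorial : ℂ) ≠ 0 := by exact_mod_cast m.factorial_ne_zero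
    have h2 : ((m : ℂ) + 1) ≠ 0 := by exact_mod_cast m.succ_ne_zero
    push_cast
    field_simp
  rw [integrateSimplex, setIntegral_congr_fun (measurableSet_simplex _) hconst, setIntegral_const,
    volume_real_simplex, ← Complex.coe_smul, smul_smul]
  congr 1
  push_cast
  have h1 : (m.factorial : ℂ) ≠ 0 := by exact_mod_cast m.factorial_ne_zero
  have h2 : ((m + 1).factorial : ℂ) ≠ 0 := by exact_mod_cast (m + 1).factorial_ne_zero
  field_simp

end Component

end SimplicialDeRham

end

/-! ### The main theorem -/

open SimplicialDeRham in
theorem mainTheorem5 (n p : ℕ) (hp : 1 ≤ p) :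
    (∃ Φ : SimplicialForm n (2 * p), IsChernWeilForm p Φ) ∧
    ∀ Φ : SimplicialForm n (2 * p), IsChernWeilForm p Φ →
      ∀ h ∈ NG n p,
        integrateSimplex Φ p p (two_mul p) h =
          ((-1 : ℂ) ^ (p * (p - 1) / 2) * (1 / ((p.factorial : ℂ) * ((p - 1).factorial : ℂ))) *
              (1 / (2 * Real.pi * Complex.I)) ^ p) •
            traceForm (castDegree (Nat.add_sub_cancel' hp)
              (wedgeMul (phi (⟨0, hp⟩ : Fin p)) (alternatingSum n p))) h := by
  refine ⟨⟨chernSimplicialForm n p, isChernWeilForm_chernSimplicialForm n p⟩, fun Φ hΦ h hh => ?_⟩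
  obtain ⟨m, rfl⟩ : ∃ m, p = m + 1 := ⟨p - 1, by omega⟩
  exact integrateSimplex_eq hΦ hh (add_comm 1 m)
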